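/- Let $\mathcal A$ be a finite set, $\mathcal H_E$ a finite-dimensional Hilbert space, $P$ a probability distribution on $\mathcal A$ and $\rho_a$ ($a\in\mathcal A$) density operators on $\mathcal H_E$. Put $\rho=\sum_a P(a)|a\rangle\langle a|\otimes\rho_a$. With natural logarithms and $0\log 0=0$, let $H(\sigma)=-\operatorname{Tr}\sigma\log\sigma$ and $D(\sigma\|\tau)=\operatorname{Tr}\sigma(\log\sigma-\log\tau)$. For a state $\sigma$ of a classical system $A$ and a system $E$, with reduced states $\sigma^A,\sigma^E$ and with $\sigma^A_{\rm mix}$ the completely mixed state on $A$, let $$H(A|\sigma)=H(\sigma^A),\quad H(A|E|\sigma)=H(\sigma)-H(\sigma^E),\quad I(A:E|\sigma)=D(\sigma\|\sigma^A\otimes\sigma^E),\quad I'(A:E|\sigma)=D(\sigma\|\sigma^A_{\rm mix}\otimes\sigma^E).$$ For a function $f$ on the values of $A$, write $f(A)$ in place of $A$ when the state is $\sum_a P(a)|f(a)\rangle\langle f(a)|\otimes\rho_a$. Regard $\rho^{\otimes n}$ as a state of $A^n$ and $E^{\otimes n}$. The optimal generation rate is $$G(\rho)=\sup\Big\{\lim_{n\to\infty}\tfrac{\log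 M_n}{n}\ \Big|\ \lim_{n\to\infty}\tfrac{I(f_n(A):E|\rho^{\otimes n})}{n}=0,\ \lim_{n\to\infty}\tfrac{H(f_n(A)|\rho^{\otimes n})}{\log M_n}=1\Big\},$$ where the supremum, taken in $[0,\infty]$ (with $\sup\emptyset=0$), is over all sequences of functions $f_n:\mathcal A^n\to\{1,\dots,M_n\}$ for which $\lim_{n\to\infty}\frac{\log M_n}{n}$ exists. Then $$G(\rho)=\sup\Big\{\lim_{n\to\infty}\tfrac{\log M_n}{n}\ \Big|\ \lim_{n\to\infty}\tfrac{I'(f_n(A):E|\rho^{\otimes n})}{n}=0\Big\}=H(A|E|\rho).$$ A random function $f_{X}$ from a finite set $\mathcal B$ to $\{1,\dots,M\}$ is called universal$_2$ if $\Pr[f_{X}(b_1)=f_{X}(b_2)]\le\frac1M$ for all $b_1\ne b_2$ in $\mathcal B$. The rate $H(A|E|\rho)$ is also optimal under universal$_2$ privacy amplification: the supremum of $\lim_{n\to\infty}\frac{\log M_n}{n}$ over all sequences of universal$_2$ random functions $f_{X_n}:\mathcal A^n\to\{1,\dots,M_n\}$ with $\lim_{n\to\infty}\frac1n\mathbb E_{X_n}I'(f_{X_n}(A):E|\rho^{\otimes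 n})=0$ equals $H(A|E|\rho)$. Moreover, for every sequence of universal$_2$ random functions $f_{X_n}:\mathcal A^n\to\{1,\dots,M_n\}$ with $\lim_{n\to\infty}\frac{\log M_n}{n}=R<H(A|E|\rho)$, there is $c>0$ such that $\mathbb E_{X_n}I'(f_{X_n}(A):E|\rho^{\otimes n})\le e^{-cn}$ for all sufficiently large $n$. -/

import Mathlib

open Filter Topology
open scoped Kronecker ENNReal BigOperators ComplexOrder

noncomputable section

namespace SecretKey

/-! ### Matrix entropies

All logarithms are natural. `matLog` is the functional calculus of `Real.log`; since
`Real.log 0 = 0` it is the logarithm on the support of a positive semidefinite matrix and `0` on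
its kernel, so that `0 log 0 = 0`. -/

section Entropy

variable {m : Type*} [Fintype m] [DecidableEq m]

/-- The logarithm of a Hermitian matrix, taken on its support. -/
def matLog (X : Matrix m m ℂ) : Matrix m m ℂ := cfc Real.log X

/-- The von Neumann entropy `-Tr ρ log ρ`. -/
def vnEntropy (ρ : Matrix m m ℂ) : ℝ := -(ρ * matLog ρ).trace.re

/-- The relative entropy `D(ρ‖σ) = Tr ρ (log ρ - log σ)`. This formula is the relative entropy
whenever the support of `ρ` lies in that of `σ`. It is used below only for `σ = ρ_A ⊗ ρ_E` and
`σ = mix_A ⊗ ρ_E`, where this is always so. -/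
def relEntropy (ρ σ : Matrix m m ℂ) : ℝ := (ρ * (matLog ρ - matLog σ)).trace.re

end Entropy

/-! ### Composite systems `A ⊗ E` -/

section Composite

variable {A B E : Type*} [Fintype A] [DecidableEq A] [Fintype E] [DecidableEq E]

/-- The reduced state on `E`, i.e. the partial trace over `A`. -/
def margE (ρ : Matrix (A × E) (A × E) ℂ) : Matrix E E ℂ :=
  Matrix.of fun i j => ∑ a, ρ (a, i) (a, j)

/-- The reduced state on `A`, i.e. the partial trace over `E`. -/
def margA (ρ : Matrix (A × E) (A × E) ℂ) : Matrix A A ℂ :=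
  Matrix.of fun a b => ∑ i, ρ (a, i) (b, i)

/-- The completely mixed state on `A`. -/
def mixed (A : Type*) [Fintype A] [DecidableEq A] : Matrix A A ℂ :=
  (Fintype.card A : ℂ)⁻¹ • (1 : Matrix A A ℂ)

/-- `H(A|ρ)`, the entropy of the reduced state on `A`. -/
def entropyA (ρ : Matrix (A × E) (A × E) ℂ) : ℝ := vnEntropy (margA ρ)

/-- The conditional entropy `H(A|E|ρ) = H(A,E|ρ) - H(E|ρ)`. -/
def condEntropy (ρ : Matrix (A × E) (A × E) ℂ) : ℝ := vnEntropy ρ - vnEntropy (margE ρ)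

/-- The mutual information `I(A:E|ρ) = D(ρ ‖ ρ_A ⊗ ρ_E)`. -/
def mutualInfo (ρ : Matrix (A × E) (A × E) ℂ) : ℝ := relEntropy ρ (margA ρ ⊗ₖ margE ρ)

/-- The modified mutual information `I'(A:E|ρ) = D(ρ ‖ mix_A ⊗ ρ_E)`. -/
def mutualInfo' (ρ : Matrix (A × E) (A × E) ℂ) : ℝ := relEntropy ρ (mixed A ⊗ₖ margE ρ)

/-- The state of `f(A), E` when `f` is applied to the classical system `A`: its block at `(b, b)`
is the sum of the blocks of `ρ` at `(a, a)` over all `a` with `f a = b`, and its off-diagonal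
blocks vanish. -/
def applyFun [DecidableEq B] (f : A → B) (ρ : Matrix (A × E) (A × E) ℂ) :
    Matrix (B × E) (B × E) ℂ :=
  Matrix.of fun x y =>
    if x.1 = y.1 then ∑ a, (if f a = x.1 then ρ (a, x.2) (a, y.2) else 0) else 0

/-- The `n`-fold tensor power, a state on `Aⁿ ⊗ E^{⊗n}`. -/
def tensorPow (n : ℕ) (ρ : Matrix (A × E) (A × E) ℂ) :
    Matrix ((Fin n → A) × (Fin n → E)) ((Fin n → A) × (Fin n → E)) ℂ :=
  Matrix.of fun x y => ∏ i, ρ (x.1 i, x.2 i) (y.1 i, y.2 i)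

end Composite

/-- A classical-quantum ensemble: a probability distribution on the finite set `A` together with,
for each `a`, a density matrix on the finite-dimensional space `ℂ^E`. -/
structure CQState (A E : Type*) [Fintype A] [Fintype E] where
  prob : A → ℝ
  state : A → Matrix E E ℂ
  prob_nonneg : ∀ a, 0 ≤ prob a
  prob_sum : ∑ a, prob a = 1
  state_posSemidef : ∀ a, (state a).PosSemidef
  state_trace : ∀ a, (state a).trace = 1

/-- The composite state `∑ a, P(a) |a⟩⟨a| ⊗ ρ_a`. -/
def CQState.density {A E : Type*} [Fintype A] [DecidableEq A] [Fintype E] (ρ : CQState A E) :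
    Matrix (A × E) (A × E) ℂ :=
  ∑ a, (ρ.prob a : ℂ) • (Matrix.single a a (1 : ℂ) ⊗ₖ ρ.state a)

/-! ### Universal₂ ensembles of hash functions -/

/-- A random function from `α` to a set of `M` elements, given through its law. -/
structure HashEnsemble (α : Type*) [Fintype α] [DecidableEq α] (M : ℕ) where
  weight : (α → Fin M) → ℝ
  weight_nonneg : ∀ f, 0 ≤ weight f
  weight_sum : ∑ f, weight f = 1

namespace HashEnsemble

variable {α : Type*} [Fintype α] [DecidableEq α] {M : ℕ}

/-- The expectation of `g(f)` for a random function `f`. -/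
def expect (X : HashEnsemble α M) (g : (α → Fin M) → ℝ) : ℝ := ∑ f, X.weight f * g f

/-- Two distinct inputs collide with probability at most `1 / M`. -/
def IsUniversal2 (X : HashEnsemble α M) : Prop :=
  ∀ a₁ a₂ : α, a₁ ≠ a₂ → (∑ f, if f a₁ = f a₂ then X.weight f else 0) ≤ 1 / (M : ℝ)

end HashEnsemble

/-! ### Optimal generation rates

Rates are elements of `[0, ∞]`, where every set has a supremum, the empty one having supremum `0`.
The set `Aⁿ` of a state is non-empty, so the existence of `f n` forces `M n ≥ 1`. -/

section Rates

variable {A E : Type*} [Fintype A] [DecidableEq A] [Fintype E] [DecidableEq E]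

/-- The sequence of key sizes `M n` has generation rate `lim (log M n) / n = R`. -/
def HasRate (M : ℕ → ℕ) (R : ℝ≥0∞) : Prop :=
  Tendsto (fun n : ℕ => ENNReal.ofReal (Real.log (M n) / n)) atTop (𝓝 R)

/-- The optimal generation rate `G(ρ)`: the supremum of the rates of sequences `(f n, M n)` with
`I(f n(A) : E) / n → 0` and `H(f n(A)) / log (M n) → 1`. -/
def optimalRate (ρ : CQState A E) : ℝ≥0∞ :=
  sSup {R | ∃ (M : ℕ → ℕ) (f : ∀ n, (Fin n → A) → Fin (M n)),
    HasRate M R ∧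
    Tendsto (fun n : ℕ => mutualInfo (applyFun (f n) (tensorPow n ρ.density)) / n)
      atTop (𝓝 0) ∧
    Tendsto (fun n : ℕ => entropyA (applyFun (f n) (tensorPow n ρ.density)) / Real.log (M n))
      atTop (𝓝 1)}

/-- The same with the single condition `I'(f n(A) : E) / n → 0`. -/
def optimalRate' (ρ : CQState A E) : ℝ≥0∞ :=
  sSup {R | ∃ (M : ℕ → ℕ) (f : ∀ n, (Fin n → A) → Fin (M n)),
    HasRate M R ∧
    Tendsto (fun n : ℕ => mutualInfo' (applyFun (f n) (tensorPow n ρ.density)) / n)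
      atTop (𝓝 0)}

/-- The expectation of `I'(f(A) : E | ρ^{⊗n})` over a random function `f` on `Aⁿ`. -/
def meanLeak (ρ : CQState A E) {n M : ℕ} (X : HashEnsemble (Fin n → A) M) : ℝ :=
  X.expect fun f => mutualInfo' (applyFun f (tensorPow n ρ.density))

/-- The optimal generation rate when `f n` is drawn from a universal₂ ensemble, the criterion being
averaged over the ensemble. -/
def optimalRateUniversal2 (ρ : CQState A E) : ℝ≥0∞ :=
  sSup {R | ∃ (M : ℕ → ℕ) (X : ∀ n, HashEnsemble (Fin n → A) (M n)),
    (∀ n, (X n).IsUniversal2) ∧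
    HasRate M R ∧
    Tendsto (fun n : ℕ => meanLeak ρ (X n) / n) atTop (𝓝 0)}

end Rates

end SecretKey

end

set_option linter.unusedSectionVars false

namespace SecretKey

open Matrix

/-! ### Diagonalisations -/

section Diagonalisation

variable {m ι κ : Type*} [Fintype m] [DecidableEq m] [Fintype ι] [DecidableEq ι]
  [Fintype κ] [DecidableEq κ]

/-! Write `X a` for the unnormalised states `P(a) ρ_a` and `Z = ∑ a, X a`.

Converse. Klein-type computations give `I' = log M - H(f(A)|E)` and `I = H(f(A)) - H(f(A)|E)`.
Applying a function to a classical system cannot raise its conditional entropy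
(`condEntropy_applyFun_le`), and conditional entropy is additive on tensor powers
(`condEntropy_tensorPow`). Hence `log M ≤ I' + n H(A|E)`; the same bound with `H(f(A))` on the left
and `I` on the right settles `G`, because there `H(f(A))` and `log M` are asymptotically equal.

Achievability rests on the one-shot bound `expect_mutualInfo'_le`: for universal₂ hashing and `0 < s
≤ 1`, the mean of `I'` is at most `(v M)^s / s * ∑ a, Tr (X a)^(1+s) Z^(-s)`, where `v` bounds the
number of distinct eigenvalues of `Z`. Operator concavity of the logarithm moves the expectation
inside, universality bounds the averaged fibre by `X a + Z / M`, and the pinching inequality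
replaces `X a` by `v` times an operator commuting with `Z`. What is left is `log (1 + t) ≤ t^s / s`
and Jensen's inequality.

On `n` copies `v` is polynomial in `n`, since an eigenvalue of `Z^{⊗n}` depends only on letter
counts, and the trace is an `n`-th power. The trace is the moment generating function of the log
ratio of eigenvalues under a classical joint distribution (`jointWeight`), and that log ratio has
mean `-H(A|E)`. So for `R < H(A|E)` the exponent has negative slope at `s = 0`, and some small `s`
gives exponential decay. A random function being universal₂, and some function being no worse than
the average, the rate is attained by deterministic functions as well. -/

/-- `X = V diag(d) Vᴴ` with `V` unitary, possibly with a different column index type. -/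
structure IsDiag (V : Matrix m ι ℂ) (d : ι → ℝ) (X : Matrix m m ℂ) : Prop where
  conj_mul : Vᴴ * V = 1
  mul_conj : V * Vᴴ = 1
  eq : X = V * diagonal (fun j => (d j : ℂ)) * Vᴴ

/-- The diagonal entries of `Y` in the basis given by the columns of `V`. -/
noncomputable def weight (V : Matrix m ι ℂ) (Y : Matrix m m ℂ) (j : ι) : ℝ :=
  ((Vᴴ * Y * V) j j).re

/-- The squared overlaps of the columns of `U` and `V`. -/
noncomputable def overlap (U : Matrix m κ ℂ) (V : Matrix m ι ℂ) (i : κ) (j : ι) : ℝ :=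
  Complex.normSq ((Uᴴ * V) i j)

lemma IsDiag.pow {V : Matrix m ι ℂ} {d : ι → ℝ} {X : Matrix m m ℂ} (h : IsDiag V d X) (n : ℕ) :
    X ^ n = V * diagonal (fun j => ((d j ^ n : ℝ) : ℂ)) * Vᴴ := by
  induction n with
  | zero => simp [h.mul_conj]
  | succ n ih =>
    rw [pow_succ, ih]
    conv_lhs => rw [h.eq]
    have : V * diagonal (fun j => ((d j ^ n : ℝ) : ℂ)) * Vᴴ *
        (V * diagonal (fun j => (d j : ℂ)) * Vᴴ) =
        V * diagonal (fun j => ((d j ^ n : ℝ) : ℂ)) * (Vᴴ * V) *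
          diagonal (fun j => (d j : ℂ)) * Vᴴ := by simp only [Matrix.mul_assoc]
    rw [this, h.conj_mul, Matrix.mul_one, Matrix.mul_assoc V, diagonal_mul_diagonal]
    simp [pow_succ]

open Polynomial in
lemma IsDiag.aeval {V : Matrix m ι ℂ} {d : ι → ℝ} {X : Matrix m m ℂ} (h : IsDiag V d X)
    (q : ℝ[X]) : aeval X q = V * diagonal (fun j => ((q.eval (d j) : ℝ) : ℂ)) * Vᴴ := by
  induction q using Polynomial.induction_on' with
  | add p q hp hq =>
    rw [map_add, hp, hq, ← Matrix.add_mul, ← Matrix.mul_add, diagonal_add]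
    simp
  | monomial n a =>
    rw [aeval_monomial, h.pow, ← Algebra.smul_def]
    rw [← Matrix.smul_mul, ← Matrix.mul_smul]
    congr 2
    ext i j
    by_cases hij : i = j <;> simp [hij]

lemma IsDiag.isHermitian {V : Matrix m ι ℂ} {d : ι → ℝ} {X : Matrix m m ℂ} (h : IsDiag V d X) :
    X.IsHermitian := by
  rw [IsHermitian, h.eq]
  simp only [conjTranspose_mul, conjTranspose_conjTranspose, diagonal_conjTranspose,
    Matrix.mul_assoc]
  congr 3
  ext j
  simp

lemma IsDiag.cfc {V : Matrix m ι ℂ} {d : ι → ℝ} {X : Matrix m m ℂ} (h : IsDiag V d X)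
    (f : ℝ → ℝ) : IsDiag V (fun j => f (d j)) (cfc f X) := by
  classical
  refine ⟨h.conj_mul, h.mul_conj, ?_⟩
  have hX : IsSelfAdjoint X := h.isHermitian
  have hfin : (spectrum ℝ X).Finite := Matrix.finite_real_spectrum
  -- The nodes contain both the spectrum and all `d j`, so the interpolant agrees with `f` on each
  -- without the two sets having to be identified.
  set s : Finset ℝ := hfin.toFinset ∪ Finset.univ.image d
  set q := Lagrange.interpolate s id f
  have hq : ∀ x ∈ s, q.eval x = f x := fun x hx => by
    exact Lagrange.eval_interpolate_at_node (v := id) f (Function.injective_id.injOn) hx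
  have h1 : _root_.cfc f X = _root_.cfc q.eval X := by
    refine cfc_congr fun x hx => (hq x ?_).symm
    simp [s, hx]
  rw [h1, cfc_polynomial q X hX, h.aeval]
  congr 3
  ext j
  rw [hq _ (by simp [s])]

lemma exists_isDiag {X : Matrix m m ℂ} (hX : X.IsHermitian) :
    ∃ (V : Matrix m m ℂ) (d : m → ℝ), IsDiag V d X := by
  refine ⟨hX.eigenvectorUnitary, hX.eigenvalues, ?_, ?_, ?_⟩
  · exact Unitary.coe_star_mul_self hX.eigenvectorUnitary
  · exact Unitary.coe_mul_star_self hX.eigenvectorUnitary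
  · exact hX.spectral_theorem

lemma weight_nonneg {V : Matrix m ι ℂ} {Y : Matrix m m ℂ} (hY : Y.PosSemidef) (j : ι) :
    0 ≤ weight V Y j :=
  (Complex.le_def.mp ((hY.conjTranspose_mul_mul_same V).diag_nonneg (i := j))).1

lemma weight_sub (V : Matrix m ι ℂ) (Y Z : Matrix m m ℂ) (j : ι) :
    weight V (Y - Z) j = weight V Y j - weight V Z j := by
  simp [weight, Matrix.mul_sub, Matrix.sub_mul]

lemma IsDiag.weight_self {V : Matrix m ι ℂ} {d : ι → ℝ} {X : Matrix m m ℂ} (h : IsDiag V d X)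
    (j : ι) : weight V X j = d j := by
  have : Vᴴ * X * V = (Vᴴ * V) * diagonal (fun j => (d j : ℂ)) * (Vᴴ * V) := by
    rw [h.eq]; simp only [Matrix.mul_assoc]
  rw [weight, this, h.conj_mul]
  simp

lemma IsDiag.nonneg {V : Matrix m ι ℂ} {d : ι → ℝ} {X : Matrix m m ℂ} (h : IsDiag V d X)
    (hX : X.PosSemidef) (j : ι) : 0 ≤ d j :=
  h.weight_self j ▸ weight_nonneg hX j

/-- An operator dominated by `Z` vanishes on the kernel of `Z`. This is the support condition that
makes the convention `log 0 = 0` harmless throughout. -/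
lemma weight_eq_zero {V : Matrix m ι ℂ} {d : ι → ℝ} {Y Z : Matrix m m ℂ} (h : IsDiag V d Z)
    (hY : Y.PosSemidef) (hYZ : (Z - Y).PosSemidef) {j : ι} (hj : d j = 0) :
    weight V Y j = 0 := by
  have h1 := weight_nonneg (V := V) hYZ j
  rw [weight_sub, h.weight_self, hj] at h1
  linarith [weight_nonneg (V := V) hY j]

lemma IsDiag.trace_mul {V : Matrix m ι ℂ} {d : ι → ℝ} {X : Matrix m m ℂ} (h : IsDiag V d X)
    (Y : Matrix m m ℂ) : (Y * X).trace.re = ∑ j, weight V Y j * d j := by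
  have : (Y * X).trace = ((Vᴴ * Y * V) * diagonal (fun j => (d j : ℂ))).trace := by
    rw [h.eq, ← Matrix.mul_assoc, trace_mul_comm]
    simp only [Matrix.mul_assoc]
  rw [this, trace, Complex.re_sum]
  refine Finset.sum_congr rfl fun j _ => ?_
  simp [weight, mul_diagonal]

lemma IsDiag.trace_mul_cfc {V : Matrix m ι ℂ} {d : ι → ℝ} {X : Matrix m m ℂ}
    (h : IsDiag V d X) (Y : Matrix m m ℂ) (f : ℝ → ℝ) :
    (Y * _root_.cfc f X).trace.re = ∑ j, weight V Y j * f (d j) :=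
  (h.cfc f).trace_mul Y

lemma IsDiag.trace_re {V : Matrix m ι ℂ} {d : ι → ℝ} {X : Matrix m m ℂ}
    (h : IsDiag V d X) (Y : Matrix m m ℂ) : Y.trace.re = ∑ j, weight V Y j := by
  have h1 : IsDiag V (fun _ => 1) (1 : Matrix m m ℂ) :=
    ⟨h.conj_mul, h.mul_conj, by simp [h.mul_conj]⟩
  simpa using h1.trace_mul Y

lemma IsDiag.trace_self {V : Matrix m ι ℂ} {d : ι → ℝ} {X : Matrix m m ℂ}
    (h : IsDiag V d X) : X.trace.re = ∑ j, d j := by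
  simp [h.trace_re, h.weight_self]

lemma IsDiag.weight_eq_sum_overlap {U : Matrix m κ ℂ} {l : κ → ℝ} {X : Matrix m m ℂ}
    (h : IsDiag U l X) (V : Matrix m ι ℂ) (j : ι) :
    weight V X j = ∑ i, l i * overlap U V i j := by
  have : Vᴴ * X * V = (Uᴴ * V)ᴴ * diagonal (fun i => (l i : ℂ)) * (Uᴴ * V) := by
    rw [h.eq]; simp [Matrix.mul_assoc]
  rw [weight, this, Matrix.mul_apply, Complex.re_sum]
  refine Finset.sum_congr rfl fun i _ => ?_
  rw [mul_diagonal, conjTranspose_apply, overlap, Complex.normSq_apply]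
  simp
  ring

lemma overlap_nonneg (U : Matrix m κ ℂ) (V : Matrix m ι ℂ) (i : κ) (j : ι) :
    0 ≤ overlap U V i j := Complex.normSq_nonneg _

lemma sum_overlap_left {U : Matrix m κ ℂ} {V : Matrix m ι ℂ} (hU : U * Uᴴ = 1) (hV : Vᴴ * V = 1)
    (j : ι) : ∑ i, overlap U V i j = 1 := by
  have h : ((Uᴴ * V)ᴴ * (Uᴴ * V)) = 1 := by
    rw [conjTranspose_mul, conjTranspose_conjTranspose, Matrix.mul_assoc, ← Matrix.mul_assoc U, hU,
      Matrix.one_mul, hV]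
  have h2 := congrArg Complex.re (congrFun (congrFun h j) j)
  rw [Matrix.mul_apply, Complex.re_sum] at h2
  simp only [conjTranspose_apply, one_apply_eq, Complex.one_re] at h2
  rw [← h2]
  refine Finset.sum_congr rfl fun i _ => ?_
  rw [overlap, Complex.normSq_apply]
  simp

lemma sum_overlap_right {U : Matrix m κ ℂ} {V : Matrix m ι ℂ} (hU : Uᴴ * U = 1) (hV : V * Vᴴ = 1)
    (i : κ) : ∑ j, overlap U V i j = 1 := by
  rw [← sum_overlap_left hV hU i]
  refine Finset.sum_congr rfl fun j _ => ?_
  rw [overlap, overlap, ← Complex.normSq_conj]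
  congr 1
  have : Vᴴ * U = (Uᴴ * V)ᴴ := by simp
  rw [this]
  simp

/-- The left side does not mention the eigenbases, so the double sum may be transferred from one
diagonalisation to another. -/
lemma IsDiag.trace_cfc_mul_cfc {U : Matrix m κ ℂ} {l : κ → ℝ} {X : Matrix m m ℂ}
    (hX : IsDiag U l X) {V : Matrix m ι ℂ} {d : ι → ℝ} {Z : Matrix m m ℂ} (hZ : IsDiag V d Z)
    (f g : ℝ → ℝ) : (_root_.cfc f X * _root_.cfc g Z).trace.re =
      ∑ i, ∑ j, f (l i) * overlap U V i j * g (d j) := by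
  rw [hZ.trace_mul_cfc, Finset.sum_comm]
  refine Finset.sum_congr rfl fun j _ => ?_
  rw [(hX.cfc f).weight_eq_sum_overlap, Finset.sum_mul]

lemma IsDiag.add_smul_one {V : Matrix m ι ℂ} {d : ι → ℝ} {X : Matrix m m ℂ} (h : IsDiag V d X)
    (ε : ℝ) : IsDiag V (fun j => d j + ε) (X + (ε : ℂ) • 1) := by
  refine ⟨h.conj_mul, h.mul_conj, ?_⟩
  rw [h.eq]
  have : (diagonal fun j => ((d j + ε : ℝ) : ℂ)) =
      diagonal (fun j => (d j : ℂ)) + (ε : ℂ) • (1 : Matrix ι ι ℂ) := by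
    ext i j
    by_cases hij : i = j <;> simp [hij, one_apply]
  rw [this, Matrix.mul_add, Matrix.add_mul]
  simp [h.mul_conj]

lemma IsDiag.smul {V : Matrix m ι ℂ} {d : ι → ℝ} {X : Matrix m m ℂ} (h : IsDiag V d X)
    (c : ℝ) : IsDiag V (fun j => c * d j) ((c : ℂ) • X) := by
  refine ⟨h.conj_mul, h.mul_conj, ?_⟩
  rw [h.eq]
  have : (diagonal fun j => ((c * d j : ℝ) : ℂ)) = (c : ℂ) • diagonal (fun j => (d j : ℂ)) := by
    ext i j
    by_cases hij : i = j <;> simp [hij]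
  rw [this]
  simp

lemma IsDiag.add {V : Matrix m ι ℂ} {d e : ι → ℝ} {X Y : Matrix m m ℂ} (h : IsDiag V d X)
    (h' : IsDiag V e Y) : IsDiag V (fun j => d j + e j) (X + Y) := by
  refine ⟨h.conj_mul, h.mul_conj, ?_⟩
  rw [h.eq, h'.eq, ← Matrix.add_mul, ← Matrix.mul_add, diagonal_add]
  simp

end Diagonalisation

/-! ### Order properties of the logarithm -/

section LogOrder

variable {m ι : Type*} [Fintype m] [DecidableEq m] [Fintype ι] [DecidableEq ι]

lemma trace_mul_re_nonneg {X Y : Matrix m m ℂ} (hX : X.PosSemidef) (hY : Y.PosSemidef) :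
    0 ≤ (X * Y).trace.re := by
  obtain ⟨V, d, h⟩ := exists_isDiag hY.isHermitian
  rw [h.trace_mul]
  exact Finset.sum_nonneg fun j _ => mul_nonneg (weight_nonneg hX j) (h.nonneg hY j)

open scoped MatrixOrder Matrix.Norms.L2Operator in
lemma posSemidef_matLog_sub {X Y : Matrix m m ℂ} (hX : X.PosDef) (hXY : (Y - X).PosSemidef) :
    (matLog Y - matLog X).PosSemidef :=
  CFC.log_le_log (a := X) (b := Y) hXY hX.isStrictlyPositive

open scoped MatrixOrder Matrix.Norms.L2Operator in
lemma posSemidef_matLog_sum {α : Type*} (s : Finset α) {w : α → ℝ} {X : α → Matrix m m ℂ}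
    (hw : ∀ a ∈ s, 0 ≤ w a) (hs : ∑ a ∈ s, w a = 1) (hX : ∀ a ∈ s, (X a).PosDef) :
    (matLog (∑ a ∈ s, (w a : ℂ) • X a) - ∑ a ∈ s, (w a : ℂ) • matLog (X a)).PosSemidef := by
  have h := (CFC.concaveOn_log (A := Matrix m m ℂ)).le_map_sum hw hs
    (fun a ha => (hX a ha).isStrictlyPositive)
  exact h

end LogOrder

/-! ### Traces against logarithms on the support, and Klein's inequality. -/

section TraceLog

variable {m ι : Type*} [Fintype m] [DecidableEq m] [Fintype ι] [DecidableEq ι]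

lemma tendsto_mul_log_add {w d : ℝ} (h : d = 0 → w = 0) :
    Tendsto (fun ε : ℝ => w * Real.log (d + ε)) (𝓝[>] 0) (𝓝 (w * Real.log d)) := by
  by_cases hd : d = 0
  · simp [h hd]
  · refine Tendsto.const_mul _ ?_
    have h1 : Tendsto (fun ε : ℝ => d + ε) (𝓝[>] 0) (𝓝 (d + 0)) :=
      (tendsto_const_nhds.add tendsto_id).mono_left nhdsWithin_le_nhds
    rw [add_zero] at h1
    exact h1.log hd

/-- The regularised logarithm diverges on the kernel of `Z`, but `Y` has no weight there. Facts
proved for positive definite matrices thus pass to semidefinite ones. -/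
lemma tendsto_trace_mul_matLog {V : Matrix m ι ℂ} {d : ι → ℝ} {Y Z : Matrix m m ℂ}
    (hZ : IsDiag V d Z) (h : ∀ j, d j = 0 → weight V Y j = 0) :
    Tendsto (fun ε : ℝ => (Y * matLog (Z + (ε : ℂ) • 1)).trace.re) (𝓝[>] 0)
      (𝓝 (Y * matLog Z).trace.re) := by
  simp only [matLog, fun ε : ℝ => (hZ.add_smul_one ε).trace_mul_cfc Y Real.log,
    hZ.trace_mul_cfc Y Real.log]
  exact tendsto_finsetSum _ fun j _ => tendsto_mul_log_add (h j)

lemma posDef_add_smul_one {X : Matrix m m ℂ} (hX : X.PosSemidef) {ε : ℝ} (hε : 0 < ε) :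
    (X + (ε : ℂ) • 1).PosDef := by
  refine PosDef.posSemidef_add hX (PosDef.smul PosDef.one ?_)
  exact_mod_cast hε

lemma trace_mul_matLog_mono {X Y Z : Matrix m m ℂ} (hX : X.PosSemidef) (hY : Y.PosDef)
    (hYZ : (Z - Y).PosSemidef) : (X * matLog Y).trace.re ≤ (X * matLog Z).trace.re := by
  have h := trace_mul_re_nonneg hX (posSemidef_matLog_sub hY hYZ)
  rw [Matrix.mul_sub, trace_sub, Complex.sub_re] at h
  linarith

/-- The logarithm on the support is monotone when tested against an operator dominated by both
arguments. -/
lemma trace_mul_matLog_le_of_le {X Y Z : Matrix m m ℂ} (hX : X.PosSemidef) (hY : Y.PosSemidef)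
    (hXY : (Y - X).PosSemidef) (hYZ : (Z - Y).PosSemidef) :
    (X * matLog Y).trace.re ≤ (X * matLog Z).trace.re := by
  have hZ : Z.PosSemidef := by simpa using hYZ.add hY
  have hXZ : (Z - X).PosSemidef := by simpa using hYZ.add hXY
  obtain ⟨U, l, hU⟩ := exists_isDiag hY.isHermitian
  obtain ⟨V, d, hV⟩ := exists_isDiag hZ.isHermitian
  refine le_of_tendsto_of_tendsto
    (tendsto_trace_mul_matLog (Y := X) hU fun j hj => weight_eq_zero hU hX hXY hj)
    (tendsto_trace_mul_matLog (Y := X) hV fun j hj => weight_eq_zero hV hX hXZ hj) ?_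
  filter_upwards [self_mem_nhdsWithin] with ε hε
  refine trace_mul_matLog_mono hX (posDef_add_smul_one hY hε) ?_
  simpa using hYZ

lemma posSemidef_sum_sub {α : Type*} [Fintype α] {X : α → Matrix m m ℂ}
    (hX : ∀ a, (X a).PosSemidef) (a : α) : (∑ b, X b - X a).PosSemidef := by
  classical
  rw [← Finset.add_sum_erase _ _ (Finset.mem_univ a), add_sub_cancel_left]
  exact posSemidef_sum _ fun b _ => hX b

lemma trace_sum_mul_re {α : Type*} (s : Finset α) (X : α → Matrix m m ℂ) (L : Matrix m m ℂ) :
    ((∑ a ∈ s, X a) * L).trace.re = ∑ a ∈ s, (X a * L).trace.re := by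
  rw [Finset.sum_mul, trace_sum, Complex.re_sum]

/-- The unnormalised entropy is subadditive under sums. -/
lemma vnEntropy_sum_le {α : Type*} [Fintype α] {X : α → Matrix m m ℂ}
    (hX : ∀ a, (X a).PosSemidef) : vnEntropy (∑ a, X a) ≤ ∑ a, vnEntropy (X a) := by
  simp only [vnEntropy]
  rw [trace_sum_mul_re, Finset.sum_neg_distrib]
  refine neg_le_neg (Finset.sum_le_sum fun a _ => ?_)
  exact trace_mul_matLog_le_of_le (hX a) (hX a) (by simpa using PosSemidef.zero)
    (posSemidef_sum_sub hX a)

lemma mul_log_sub_mul_log_ge {y z : ℝ} (hy : 0 ≤ y) (hz : 0 < z) :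
    y - z ≤ y * Real.log y - y * Real.log z := by
  rcases hy.eq_or_lt with rfl | hy
  · simp [hz.le]
  · have h := Real.log_le_sub_one_of_pos (div_pos hz hy)
    rw [Real.log_div hz.ne' hy.ne'] at h
    have h2 := mul_le_mul_of_nonneg_left h hy.le
    have h3 : y * (z / y - 1) = z - y := by field_simp
    rw [h3] at h2
    linarith

/-- Klein's inequality. -/
lemma trace_sub_le_relEntropy {V : Matrix m ι ℂ} {d : ι → ℝ} {Y Z : Matrix m m ℂ}
    (hY : Y.PosSemidef) (hZ : Z.PosSemidef) (hV : IsDiag V d Z)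
    (h : ∀ j, d j = 0 → weight V Y j = 0) :
    Y.trace.re - Z.trace.re ≤ relEntropy Y Z := by
  obtain ⟨U, l, hU⟩ := exists_isDiag hY.isHermitian
  have hl := hU.nonneg hY
  have hd := hV.nonneg hZ
  -- The overlaps are doubly stochastic, so all four traces become sums over the same pairs of
  -- eigenvalues and the scalar inequality applies term by term.
  have e1 : Y.trace.re = ∑ i, ∑ j, l i * overlap U V i j := by
    rw [hU.trace_self]
    refine Finset.sum_congr rfl fun i _ => ?_
    rw [← Finset.mul_sum, sum_overlap_right hU.conj_mul hV.mul_conj, mul_one]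
  have e2 : Z.trace.re = ∑ i, ∑ j, d j * overlap U V i j := by
    rw [hV.trace_self, Finset.sum_comm]
    refine Finset.sum_congr rfl fun j _ => ?_
    rw [← Finset.mul_sum, sum_overlap_left hU.mul_conj hV.conj_mul, mul_one]
  have e3 : (Y * matLog Y).trace.re = ∑ i, ∑ j, l i * Real.log (l i) * overlap U V i j := by
    rw [matLog, hU.trace_mul_cfc]
    refine Finset.sum_congr rfl fun i _ => ?_
    rw [← Finset.mul_sum, sum_overlap_right hU.conj_mul hV.mul_conj, mul_one, hU.weight_self]
  have e4 : (Y * matLog Z).trace.re = ∑ i, ∑ j, l i * Real.log (d j) * overlap U V i j := by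
    rw [matLog, hV.trace_mul_cfc, Finset.sum_comm]
    refine Finset.sum_congr rfl fun j _ => ?_
    rw [hU.weight_eq_sum_overlap, Finset.sum_mul]
    exact Finset.sum_congr rfl fun i _ => by ring
  rw [relEntropy, Matrix.mul_sub, trace_sub, Complex.sub_re, e1, e2, e3, e4]
  simp only [← Finset.sum_sub_distrib]
  refine Finset.sum_le_sum fun i _ => Finset.sum_le_sum fun j _ => ?_
  rcases (hd j).eq_or_lt with h0 | hpos
  · have hw := h j h0.symm
    rw [hU.weight_eq_sum_overlap, Finset.sum_eq_zero_iff_of_nonneg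
      (fun i _ => mul_nonneg (hl i) (overlap_nonneg U V i j))] at hw
    have := hw i (Finset.mem_univ _)
    rcases mul_eq_zero.mp this with h1 | h1
    · simp [h1, ← h0]
    · simp [h1]
  · have := mul_le_mul_of_nonneg_right (mul_log_sub_mul_log_ge (hl i) hpos)
      (overlap_nonneg U V i j)
    linarith

lemma trace_mul_matLog_smul {V : Matrix m ι ℂ} {d : ι → ℝ} {Y Z : Matrix m m ℂ}
    (hV : IsDiag V d Z) (h : ∀ j, d j = 0 → weight V Y j = 0) {c : ℝ} (hc : c ≠ 0) :
    (Y * matLog ((c : ℂ) • Z)).trace.re =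
      Real.log c * Y.trace.re + (Y * matLog Z).trace.re := by
  rw [matLog, matLog, (hV.smul c).trace_mul_cfc, hV.trace_mul_cfc, hV.trace_re, Finset.mul_sum,
    ← Finset.sum_add_distrib]
  refine Finset.sum_congr rfl fun j _ => ?_
  by_cases hd : d j = 0
  · simp [h j hd]
  · rw [Real.log_mul hc hd]; ring

end TraceLog

/-! ### Block diagonal matrices -/

section Blocks

variable {A B E : Type*} [Fintype A] [DecidableEq A] [Fintype B] [DecidableEq B]
  [Fintype E] [DecidableEq E]

/-- The matrix `∑ a, |a⟩⟨a| ⊗ X a`. -/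
def cqMat (X : A → Matrix E E ℂ) : Matrix (A × E) (A × E) ℂ :=
  Matrix.of fun x y => if x.1 = y.1 then X x.1 x.2 y.2 else 0

lemma density_eq (ρ : CQState A E) :
    ρ.density = cqMat fun a => (ρ.prob a : ℂ) • ρ.state a := by
  ext ⟨a, i⟩ ⟨b, j⟩
  simp only [CQState.density, Matrix.sum_apply, Matrix.smul_apply, kroneckerMap_apply, cqMat,
    of_apply, smul_eq_mul, single_apply]
  by_cases hab : a = b
  · subst hab
    simp
  · simp only [hab, if_false]
    refine Finset.sum_eq_zero fun c _ => ?_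
    rw [if_neg]
    · simp
    · rintro ⟨rfl, rfl⟩; exact hab rfl

lemma margE_cqMat (X : A → Matrix E E ℂ) : margE (cqMat X) = ∑ a, X a := by
  ext i j
  simp [margE, cqMat, Matrix.sum_apply]

lemma margA_cqMat (X : A → Matrix E E ℂ) :
    margA (cqMat X) = diagonal fun a => (X a).trace := by
  ext a b
  by_cases hab : a = b <;> simp [margA, cqMat, hab, trace]

lemma applyFun_cqMat (f : A → B) (X : A → Matrix E E ℂ) :
    applyFun f (cqMat X) = cqMat fun b => ∑ a, if f a = b then X a else 0 := by
  ext ⟨b, i⟩ ⟨c, j⟩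
  simp only [applyFun, cqMat, of_apply, Matrix.sum_apply, if_true]
  congr 1
  refine Finset.sum_congr rfl fun a _ => ?_
  split_ifs <;> simp

lemma cqMat_mul (X Y : A → Matrix E E ℂ) :
    cqMat X * cqMat Y = cqMat fun a => X a * Y a := by
  ext ⟨a, i⟩ ⟨b, j⟩
  rw [Matrix.mul_apply, Fintype.sum_prod_type]
  by_cases hab : a = b
  · subst hab
    simp [cqMat, Matrix.mul_apply]
  · simp only [cqMat, of_apply, hab, if_false]
    refine Finset.sum_eq_zero fun c _ => Finset.sum_eq_zero fun k _ => ?_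
    by_cases h : a = c
    · subst h; simp [hab]
    · simp [h]

lemma cqMat_conjTranspose (X : A → Matrix E E ℂ) :
    (cqMat X)ᴴ = cqMat fun a => (X a)ᴴ := by
  ext ⟨a, i⟩ ⟨b, j⟩
  by_cases hab : a = b
  · subst hab; simp [cqMat]
  · simp [cqMat, hab, Ne.symm hab]

lemma cqMat_one : cqMat (fun _ : A => (1 : Matrix E E ℂ)) = 1 := by
  ext ⟨a, i⟩ ⟨b, j⟩
  by_cases hab : a = b <;> simp [cqMat, one_apply, hab]

lemma cqMat_sub (X Y : A → Matrix E E ℂ) :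
    cqMat X - cqMat Y = cqMat fun a => X a - Y a := by
  ext ⟨a, i⟩ ⟨b, j⟩
  by_cases hab : a = b <;> simp [cqMat, hab]

lemma trace_cqMat (X : A → Matrix E E ℂ) : (cqMat X).trace = ∑ a, (X a).trace := by
  simp [trace, cqMat, Fintype.sum_prod_type]

lemma isDiag_cqMat {X V : A → Matrix E E ℂ} {d : A → E → ℝ} (h : ∀ a, IsDiag (V a) (d a) (X a)) :
    IsDiag (cqMat V) (fun x : A × E => d x.1 x.2) (cqMat X) := by
  refine ⟨?_, ?_, ?_⟩
  · rw [cqMat_conjTranspose, cqMat_mul, ← cqMat_one]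
    exact congrArg _ (funext fun a => (h a).conj_mul)
  · rw [cqMat_conjTranspose, cqMat_mul, ← cqMat_one]
    exact congrArg _ (funext fun a => (h a).mul_conj)
  · have : diagonal (fun x : A × E => (d x.1 x.2 : ℂ)) =
        cqMat fun a => diagonal fun i => (d a i : ℂ) := by
      ext ⟨a, i⟩ ⟨b, j⟩
      by_cases hab : a = b <;> simp [cqMat, diagonal_apply, hab]
    rw [this, cqMat_conjTranspose, cqMat_mul, cqMat_mul]
    exact congrArg _ (funext fun a => (h a).eq)

lemma matLog_cqMat {X : A → Matrix E E ℂ} (hX : ∀ a, (X a).IsHermitian) :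
    matLog (cqMat X) = cqMat fun a => matLog (X a) := by
  choose V d h using fun a => exists_isDiag (hX a)
  exact ((isDiag_cqMat h).cfc Real.log).eq.trans
    (isDiag_cqMat fun a => (h a).cfc Real.log).eq.symm

lemma vnEntropy_cqMat {X : A → Matrix E E ℂ} (hX : ∀ a, (X a).IsHermitian) :
    vnEntropy (cqMat X) = ∑ a, vnEntropy (X a) := by
  simp only [vnEntropy]
  rw [matLog_cqMat hX, cqMat_mul, trace_cqMat, Complex.re_sum, Finset.sum_neg_distrib]

lemma relEntropy_cqMat {X Y : A → Matrix E E ℂ} (hX : ∀ a, (X a).IsHermitian)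
    (hY : ∀ a, (Y a).IsHermitian) :
    relEntropy (cqMat X) (cqMat Y) = ∑ a, relEntropy (X a) (Y a) := by
  simp only [relEntropy]
  rw [matLog_cqMat hX, matLog_cqMat hY, cqMat_sub, cqMat_mul, trace_cqMat, Complex.re_sum]

lemma diagonal_kronecker_eq_cqMat (p : A → ℂ) (Z : Matrix E E ℂ) :
    diagonal p ⊗ₖ Z = cqMat fun a => p a • Z := by
  ext ⟨a, i⟩ ⟨b, j⟩
  by_cases hab : a = b <;> simp [cqMat, hab]

lemma mixed_kronecker_eq_cqMat (Z : Matrix E E ℂ) :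
    mixed A ⊗ₖ Z = cqMat fun _ : A => (((Fintype.card A : ℝ)⁻¹ : ℝ) : ℂ) • Z := by
  rw [mixed, ← diagonal_one, ← diagonal_smul, diagonal_kronecker_eq_cqMat]
  simp

lemma condEntropy_cqMat {X : A → Matrix E E ℂ} (hX : ∀ a, (X a).IsHermitian) :
    condEntropy (cqMat X) = ∑ a, vnEntropy (X a) - vnEntropy (∑ a, X a) := by
  rw [condEntropy, vnEntropy_cqMat hX, margE_cqMat]

lemma condEntropy_cqMat_nonneg {X : A → Matrix E E ℂ} (hX : ∀ a, (X a).PosSemidef) :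
    0 ≤ condEntropy (cqMat X) := by
  rw [condEntropy_cqMat fun a => (hX a).isHermitian]
  linarith [vnEntropy_sum_le hX]

lemma posSemidef_fiber {X : A → Matrix E E ℂ} (hX : ∀ a, (X a).PosSemidef) (f : A → B) (b : B) :
    (∑ a, if f a = b then X a else 0).PosSemidef := by
  refine posSemidef_sum _ fun a _ => ?_
  split_ifs
  exacts [hX a, PosSemidef.zero]

lemma sum_fiber {M : Type*} [AddCommMonoid M] (X : A → M) (f : A → B) :
    ∑ b, ∑ a, (if f a = b then X a else 0) = ∑ a, X a := by
  rw [Finset.sum_comm]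
  simp

/-- Merging the blocks of each fibre lowers the joint entropy by subadditivity and leaves the state
of `E` unchanged. -/
lemma condEntropy_applyFun_le {X : A → Matrix E E ℂ} (hX : ∀ a, (X a).PosSemidef) (f : A → B) :
    condEntropy (applyFun f (cqMat X)) ≤ condEntropy (cqMat X) := by
  rw [applyFun_cqMat, condEntropy_cqMat fun a => (hX a).isHermitian,
    condEntropy_cqMat fun b => (posSemidef_fiber hX f b).isHermitian, sum_fiber]
  refine sub_le_sub_right ?_ _
  rw [← sum_fiber (fun a => vnEntropy (X a)) f]
  refine Finset.sum_le_sum fun b _ => ?_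
  refine (vnEntropy_sum_le fun a => ?_).trans (le_of_eq ?_)
  · split_ifs
    exacts [hX a, PosSemidef.zero]
  · refine Finset.sum_congr rfl fun a _ => ?_
    split_ifs
    · rfl
    · simp [vnEntropy]

/-- Common source of the formulas for `I` (with `c a` the trace of `X a`) and `I'` (with `c a = 1 /
|A|`). -/
lemma sum_relEntropy_smul {X : A → Matrix E E ℂ} (hX : ∀ a, (X a).PosSemidef) {c : A → ℝ}
    (hc : ∀ a, c a = 0 → X a = 0) :
    ∑ a, relEntropy (X a) ((c a : ℂ) • ∑ b, X b) =
      -condEntropy (cqMat X) - ∑ a, (X a).trace.re * Real.log (c a) := by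
  have hZ := posSemidef_sum Finset.univ fun a _ => hX a
  obtain ⟨V, d, hV⟩ := exists_isDiag hZ.isHermitian
  rw [condEntropy_cqMat fun a => (hX a).isHermitian, vnEntropy, trace_sum_mul_re]
  simp only [vnEntropy, Finset.sum_neg_distrib]
  have : ∀ a, relEntropy (X a) ((c a : ℂ) • ∑ b, X b) = (X a * matLog (X a)).trace.re
      - (X a).trace.re * Real.log (c a) - (X a * matLog (∑ b, X b)).trace.re := by
    intro a
    by_cases h0 : c a = 0
    · simp [hc a h0, relEntropy]
    · rw [relEntropy, Matrix.mul_sub, trace_sub, Complex.sub_re, trace_mul_matLog_smul hV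
        (fun j hj => weight_eq_zero hV (hX a) (posSemidef_sum_sub hX a) hj) h0]
      ring
  simp only [this, Finset.sum_sub_distrib]
  ring

lemma mutualInfo'_cqMat [Nonempty A] {X : A → Matrix E E ℂ} (hX : ∀ a, (X a).PosSemidef)
    (htr : ∑ a, (X a).trace = 1) :
    mutualInfo' (cqMat X) = Real.log (Fintype.card A) - condEntropy (cqMat X) := by
  have hZ := posSemidef_sum Finset.univ fun a _ => hX a
  rw [mutualInfo', mixed_kronecker_eq_cqMat, margE_cqMat,
    relEntropy_cqMat (fun a => (hX a).isHermitian)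
      (fun a => (hZ.smul (Complex.zero_le_real.mpr
        (by positivity : (0 : ℝ) ≤ (Fintype.card A : ℝ)⁻¹))).isHermitian),
    sum_relEntropy_smul hX]
  · rw [← Finset.sum_mul, ← Complex.re_sum, htr, Real.log_inv]
    simp
    ring
  · intro a h
    simp at h

lemma trace_eq_re {Y : Matrix E E ℂ} (hY : Y.PosSemidef) : Y.trace = (Y.trace.re : ℂ) := by
  have := hY.trace_nonneg
  exact Complex.eq_re_of_ofReal_le (r := 0) (by simpa using this)

lemma trace_re_nonneg {Y : Matrix E E ℂ} (hY : Y.PosSemidef) : 0 ≤ Y.trace.re :=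
  (Complex.le_def.mp hY.trace_nonneg).1

lemma entropyA_cqMat {X : A → Matrix E E ℂ} (hX : ∀ a, (X a).PosSemidef) :
    entropyA (cqMat X) = -∑ a, (X a).trace.re * Real.log (X a).trace.re := by
  rw [entropyA, margA_cqMat, vnEntropy]
  have h : IsDiag (1 : Matrix A A ℂ) (fun a => (X a).trace.re)
      (diagonal fun a => (X a).trace) := by
    refine ⟨by simp, by simp, ?_⟩
    simp only [Matrix.one_mul, conjTranspose_one, Matrix.mul_one]
    congr 1
    exact funext fun a => trace_eq_re (hX a)
  rw [matLog, h.trace_mul_cfc]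
  simp only [h.weight_self]

lemma mutualInfo_cqMat_eq {X : A → Matrix E E ℂ} (hX : ∀ a, (X a).PosSemidef) :
    mutualInfo (cqMat X) = ∑ a, relEntropy (X a) (((X a).trace.re : ℂ) • ∑ b, X b) := by
  have hZ := posSemidef_sum Finset.univ fun a _ => hX a
  rw [mutualInfo, margA_cqMat, margE_cqMat, diagonal_kronecker_eq_cqMat, relEntropy_cqMat
    (fun a => (hX a).isHermitian)
    (fun a => (hZ.smul (hX a).trace_nonneg).isHermitian)]
  exact Finset.sum_congr rfl fun a _ => by rw [← trace_eq_re (hX a)]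

lemma eq_zero_of_trace_re {Y : Matrix E E ℂ} (hY : Y.PosSemidef) (h : Y.trace.re = 0) :
    Y = 0 := by
  rw [← hY.trace_eq_zero_iff, trace_eq_re hY, h, Complex.ofReal_zero]

lemma mutualInfo_cqMat {X : A → Matrix E E ℂ} (hX : ∀ a, (X a).PosSemidef) :
    mutualInfo (cqMat X) = entropyA (cqMat X) - condEntropy (cqMat X) := by
  rw [mutualInfo_cqMat_eq hX, sum_relEntropy_smul hX fun a h => eq_zero_of_trace_re (hX a) h,
    entropyA_cqMat hX]
  ring

lemma mutualInfo_cqMat_nonneg {X : A → Matrix E E ℂ} (hX : ∀ a, (X a).PosSemidef)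
    (htr : ∑ a, (X a).trace = 1) : 0 ≤ mutualInfo (cqMat X) := by
  have hZ := posSemidef_sum Finset.univ fun a _ => hX a
  obtain ⟨V, d, hV⟩ := exists_isDiag hZ.isHermitian
  have key : ∀ a, (X a).trace.re - (((X a).trace.re : ℂ) • ∑ b, X b).trace.re ≤
      relEntropy (X a) (((X a).trace.re : ℂ) • ∑ b, X b) := by
    intro a
    refine trace_sub_le_relEntropy (hX a) ?_ (hV.smul _) fun j hj => ?_
    · rw [← trace_eq_re (hX a)]
      exact hZ.smul (hX a).trace_nonneg
    · rcases mul_eq_zero.mp hj with h | h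
      · simp [eq_zero_of_trace_re (hX a) h, weight]
      · exact weight_eq_zero hV (hX a) (posSemidef_sum_sub hX a) h
  rw [mutualInfo_cqMat_eq hX]
  -- The trace differences from Klein's inequality cancel on summing over the blocks.
  refine le_trans (le_of_eq ?_) (Finset.sum_le_sum fun a _ => key a)
  simp [trace_sum, htr]

lemma entropyA_le_log_card [Nonempty A] {X : A → Matrix E E ℂ} (hX : ∀ a, (X a).PosSemidef)
    (htr : ∑ a, (X a).trace = 1) : entropyA (cqMat X) ≤ Real.log (Fintype.card A) := by
  have hc : (0 : ℝ) < Fintype.card A := by exact_mod_cast Fintype.card_pos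
  have hs : ∑ a, (X a).trace.re = 1 := by
    rw [← Complex.re_sum, htr]; simp
  have h : ∀ a, (X a).trace.re - (Fintype.card A : ℝ)⁻¹ ≤ (X a).trace.re * Real.log (X a).trace.re
      - (X a).trace.re * Real.log (Fintype.card A : ℝ)⁻¹ := fun a =>
    mul_log_sub_mul_log_ge (trace_re_nonneg (hX a)) (by positivity)
  have h2 := Finset.sum_le_sum fun a (_ : a ∈ Finset.univ) => h a
  simp only [Finset.sum_sub_distrib, ← Finset.sum_mul, hs, Finset.sum_const, Finset.card_univ,
    nsmul_eq_mul, mul_inv_cancel₀ hc.ne', Real.log_inv] at h2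
  rw [entropyA_cqMat hX]
  linarith

end Blocks

/-! ### Pinching -/

section Pinching

variable {m F K : Type*} [Fintype m] [DecidableEq m] [Fintype F] [DecidableEq F]
  [Fintype K] [DecidableEq K]

/-- The matrix with the entries between different fibers of `κ` removed. -/
def pinch (κ : F → K) (X : Matrix F F ℂ) : Matrix F F ℂ :=
  Matrix.of fun i j => if κ i = κ j then X i j else 0

/-- The pinching inequality. -/
lemma posSemidef_card_smul_pinch_sub (κ : F → K) {X : Matrix F F ℂ} (hX : X.PosSemidef) :
    ((Fintype.card K : ℂ) • pinch κ X - X).PosSemidef := by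
  -- With `P k` the projection onto the fiber over `k`, the difference equals `½ ∑ k l, (P k - P l)
  -- X (P k - P l)`, a sum of positive terms; `D k l` is the diagonal of `P k - P l`.
  let D : K → K → F → ℂ := fun k l i => (if κ i = k then 1 else 0) - (if κ i = l then 1 else 0)
  have hD : ∀ k l, (diagonal (D k l))ᴴ = diagonal (D k l) := by
    intro k l
    rw [diagonal_conjTranspose]
    congr 1
    ext i
    simp only [D, Pi.star_apply, star_sub]
    split_ifs <;> simp
  have h : (∑ k, ∑ l, (diagonal (D k l))ᴴ * X * diagonal (D k l)).PosSemidef :=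
    posSemidef_sum _ fun k _ => posSemidef_sum _ fun l _ => hX.conjTranspose_mul_mul_same _
  have h2 : (Fintype.card K : ℂ) • pinch κ X - X =
      ((1 / 2 : ℝ) : ℂ) • ∑ k, ∑ l, (diagonal (D k l))ᴴ * X * diagonal (D k l) := by
    ext i j
    have e : ∀ k l, D k l i * X i j * D k l j =
        X i j * ((if κ i = k then (if κ j = k then 1 else 0) else 0)
          + (if κ i = l then (if κ j = l then 1 else 0) else 0)
          - (if κ i = k then 1 else 0) * (if κ j = l then 1 else 0)
          - (if κ i = l then 1 else 0) * (if κ j = k then 1 else 0)) := by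
      intro k l
      simp only [D]
      split_ifs <;> ring
    simp only [Matrix.sub_apply, Matrix.smul_apply, Matrix.sum_apply, hD, mul_diagonal, diagonal_mul, e,
      ← Finset.mul_sum, Finset.sum_sub_distrib, Finset.sum_add_distrib, pinch, of_apply,
      smul_eq_mul]
    simp only [Finset.sum_ite_eq, Finset.mem_univ, if_true, Finset.sum_const, Finset.card_univ,
      nsmul_eq_mul, ← Finset.sum_mul, mul_one]
    by_cases hij : κ i = κ j
    · simp [hij]; ring
    · simp [hij, Ne.symm hij]; ring
  rw [h2]
  exact h.smul (Complex.zero_le_real.mpr (by norm_num))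

/-- Given a diagonalisation of `Z` whose eigenvalues are constant on the fibers of `κ`, there is
another one in which the diagonal part of `X` dominates `X` up to the number of fibers. -/
lemma exists_isDiag_pinching (κ : F → K) {μ : K → ℝ} {V : Matrix m F ℂ} {X Z : Matrix m m ℂ}
    (hX : X.PosSemidef) (hZ : IsDiag V (fun j => μ (κ j)) Z) :
    ∃ (W : Matrix m (Σ k, {j // κ j = k}) ℂ) (Y : Matrix m m ℂ),
      IsDiag W (fun x => μ x.1) Z ∧ IsDiag W (weight W X) Y ∧
      ((Fintype.card K : ℂ) • Y - X).PosSemidef := by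
  set N : Matrix F F ℂ := Vᴴ * X * V with hN
  have hNp : N.PosSemidef := hX.conjTranspose_mul_mul_same V
  -- Each diagonal block of `X` in the basis `V` is diagonalised separately; the new basis is `V`
  -- followed by the block-diagonal unitary.
  let T : ∀ k, Matrix {j // κ j = k} {j // κ j = k} ℂ := fun k =>
    N.submatrix Subtype.val Subtype.val
  choose U t hU using fun k => exists_isDiag (hNp.submatrix (Subtype.val :
    {j // κ j = k} → F)).isHermitian
  set e := Equiv.sigmaFiberEquiv κ
  set BU := blockDiagonal' U with hBU
  set S := BU.submatrix e.symm id with hS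
  have hBU1 : BUᴴ * BU = 1 := by
    rw [hBU, blockDiagonal'_conjTranspose, ← blockDiagonal'_mul, ← blockDiagonal'_one]
    exact congrArg _ (funext fun k => (hU k).conj_mul)
  have hBU2 : BU * BUᴴ = 1 := by
    rw [hBU, blockDiagonal'_conjTranspose, ← blockDiagonal'_mul, ← blockDiagonal'_one]
    exact congrArg _ (funext fun k => (hU k).mul_conj)
  have hSH : Sᴴ = BUᴴ.submatrix id e.symm := rfl
  have hS1 : Sᴴ * S = 1 := by
    rw [hSH, hS, submatrix_mul_equiv, hBU1]; rfl
  have hS2 : ∀ D, S * D * Sᴴ = (BU * D * BUᴴ).submatrix e.symm e.symm := by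
    intro D
    rw [hSH, hS, show (BU.submatrix e.symm id) * D = (BU * D).submatrix e.symm id by
      ext i j; simp [Matrix.mul_apply]]
    ext i j
    simp [Matrix.mul_apply]
  have hS3 : S * Sᴴ = 1 := by
    have := hS2 1
    rw [Matrix.mul_one, Matrix.mul_one, hBU2] at this
    rw [this]
    exact submatrix_one_equiv e.symm
  -- `Z` is scalar on each block, so the rotation inside the blocks leaves it diagonal.
  have hcomm : BU * diagonal (fun x : Σ k, {j // κ j = k} => (μ x.1 : ℂ)) * BUᴴ =
      diagonal (fun x => (μ x.1 : ℂ)) := by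
    have : BU * diagonal (fun x : Σ k, {j // κ j = k} => (μ x.1 : ℂ)) =
        diagonal (fun x => (μ x.1 : ℂ)) * BU := by
      ext ⟨k, i⟩ ⟨l, j⟩
      rw [mul_diagonal, diagonal_mul]
      by_cases hkl : k = l
      · subst hkl; ring
      · simp [hBU, blockDiagonal'_apply_ne _ _ _ hkl]
    rw [this, Matrix.mul_assoc, hBU2, Matrix.mul_one]
  have hpinch : pinch κ N = S * diagonal (fun x : Σ k, {j // κ j = k} => (t x.1 x.2 : ℂ)) * Sᴴ := by
    have h1 : diagonal (fun x : Σ k, {j // κ j = k} => (t x.1 x.2 : ℂ)) =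
        blockDiagonal' fun k => diagonal fun i => (t k i : ℂ) := by
      rw [blockDiagonal'_diagonal]
    rw [hS2, h1, hBU, blockDiagonal'_conjTranspose, ← blockDiagonal'_mul,
      ← blockDiagonal'_mul]
    have h2 : (fun k => U k * (diagonal fun i => (t k i : ℂ)) * (U k)ᴴ) = T :=
      funext fun k => ((hU k).eq).symm
    rw [h2]
    have h3 : (pinch κ N).submatrix e e = blockDiagonal' T := by
      ext ⟨k, i, hi⟩ ⟨l, j, hj⟩
      by_cases hkl : k = l
      · subst hkl
        simp [pinch, T, e, hi, hj]
      · rw [blockDiagonal'_apply_ne _ _ _ hkl]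
        simp [pinch, e, hi, hj, hkl]
    rw [← h3]
    ext i j
    simp
  have hW1 : (V * S)ᴴ * (V * S) = 1 := by
    rw [conjTranspose_mul, Matrix.mul_assoc, ← Matrix.mul_assoc Vᴴ, hZ.conj_mul, Matrix.one_mul,
      hS1]
  have hW2 : (V * S) * (V * S)ᴴ = 1 := by
    rw [conjTranspose_mul, Matrix.mul_assoc, ← Matrix.mul_assoc S, hS3, Matrix.one_mul,
      hZ.mul_conj]
  have hweight : weight (V * S) X = fun x => t x.1 x.2 := by
    ext x
    have h1 : (V * S)ᴴ * X * (V * S) = Sᴴ * N * S := by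
      rw [hN, conjTranspose_mul]; simp only [Matrix.mul_assoc]
    -- Each column of `S` is supported on one fiber, so diagonal entries do not see what the
    -- pinching removes.
    have h2 : (Sᴴ * N * S) x x = (Sᴴ * pinch κ N * S) x x := by
      simp only [Matrix.mul_apply, Finset.sum_mul]
      refine Finset.sum_congr rfl fun j _ => Finset.sum_congr rfl fun i _ => ?_
      by_cases hij : κ i = κ j
      · simp [pinch, hij]
      · have : S i x = 0 ∨ S j x = 0 := by
          have hz : ∀ i, κ i ≠ x.1 → S i x = 0 := by
            intro i hi
            obtain ⟨k, x⟩ := x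
            exact blockDiagonal'_apply_ne U _ _ hi
          by_cases hi : κ i = x.1
          · exact Or.inr (hz j fun hj => hij (hi.trans hj.symm))
          · exact Or.inl (hz i hi)
        rcases this with h | h <;> simp [conjTranspose_apply, h]
    have h3 : Sᴴ * pinch κ N * S = diagonal (fun x : Σ k, {j // κ j = k} => (t x.1 x.2 : ℂ)) := by
      rw [hpinch]
      have : Sᴴ * (S * diagonal (fun x : Σ k, {j // κ j = k} => (t x.1 x.2 : ℂ)) * Sᴴ) * S =
        (Sᴴ * S) * diagonal (fun x : Σ k, {j // κ j = k} => (t x.1 x.2 : ℂ)) * (Sᴴ * S) := by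
        simp only [Matrix.mul_assoc]
      rw [this, hS1, Matrix.one_mul, Matrix.mul_one]
    rw [weight, h1, h2, h3]
    simp
  refine ⟨V * S, V * pinch κ N * Vᴴ, ⟨hW1, hW2, ?_⟩, ⟨hW1, hW2, ?_⟩, ?_⟩
  · have h1 : diagonal (fun j => (μ (κ j) : ℂ)) =
        S * diagonal (fun x : Σ k, {j // κ j = k} => (μ x.1 : ℂ)) * Sᴴ := by
      rw [hS2, hcomm]
      ext i j
      rw [submatrix_apply, diagonal_apply, diagonal_apply]
      simp only [e.symm.injective.eq_iff]
      rfl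
    rw [conjTranspose_mul]
    conv_lhs => rw [hZ.eq, h1]
    simp only [Matrix.mul_assoc]
  · rw [hweight, hpinch, conjTranspose_mul]
    simp only [Matrix.mul_assoc]
  · have h1 : (Fintype.card K : ℂ) • (V * pinch κ N * Vᴴ) - X =
        V * ((Fintype.card K : ℂ) • pinch κ N - N) * Vᴴ := by
      have h2 : V * N * Vᴴ = X := by
        have : V * (Vᴴ * X * V) * Vᴴ = (V * Vᴴ) * X * (V * Vᴴ) := by
          simp only [Matrix.mul_assoc]
        rw [hN, this, hZ.mul_conj, Matrix.one_mul, Matrix.mul_one]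
      rw [Matrix.mul_sub, Matrix.sub_mul, h2]
      simp
    rw [h1]
    exact (posSemidef_card_smul_pinch_sub κ hNp).mul_mul_conjTranspose_same V

end Pinching

/-! ### The one-shot bound for universal₂ ensembles -/

/-- Apply `log (1 + y) ≤ y` with `y = t^s` after `(1 + t)^s ≤ 1 + t^s`, the subadditivity of a power
`s ≤ 1`. -/
lemma log_one_add_le_rpow_div {t s : ℝ} (ht : 0 ≤ t) (hs : 0 < s) (hs1 : s ≤ 1) :
    Real.log (1 + t) ≤ t ^ s / s := by
  rw [le_div_iff₀ hs, mul_comm, ← Real.log_rpow (by linarith)]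
  have h1 : (1 + t) ^ s ≤ 1 + t ^ s := by
    simpa using Real.rpow_add_le_add_rpow zero_le_one ht hs.le hs1
  have h2 : 0 ≤ t ^ s := Real.rpow_nonneg ht s
  have h3 : 0 < (1 + t) ^ s := Real.rpow_pos_of_pos (by linarith) s
  calc Real.log ((1 + t) ^ s) ≤ Real.log (1 + t ^ s) := Real.log_le_log h3 h1
    _ ≤ 1 + t ^ s - 1 := Real.log_le_sub_one_of_pos (by linarith)
    _ = t ^ s := by ring

lemma mul_log_le_rpow_mul_exp {x μ v M s : ℝ} (hx : 0 ≤ x) (hμ : 0 ≤ μ) (h : μ = 0 → x = 0)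
    (hv : 0 ≤ v) (hM : 0 < M) (hs : 0 < s) (hs1 : s ≤ 1) :
    x * (Real.log (v * x + M⁻¹ * μ) + Real.log M - Real.log μ) ≤
      (v * M) ^ s / s * (x * Real.exp (s * Real.log x) * Real.exp (-s * Real.log μ)) := by
  rcases hx.eq_or_lt with rfl | hx
  · simp
  have hμ : 0 < μ := hμ.lt_of_ne fun h0 => hx.ne' (h h0.symm)
  have h1 : Real.log (v * x + M⁻¹ * μ) + Real.log M - Real.log μ =
      Real.log (1 + v * M * (x / μ)) := by
    rw [← Real.log_mul (by positivity) hM.ne', ← Real.log_div (by positivity) hμ.ne']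
    congr 1
    field_simp
    ring
  have h2 := log_one_add_le_rpow_div (t := v * M * (x / μ)) (by positivity) hs hs1
  have h3 : (v * M * (x / μ)) ^ s =
      (v * M) ^ s * (Real.exp (s * Real.log x) * Real.exp (-s * Real.log μ)) := by
    rw [Real.mul_rpow (by positivity) (by positivity), Real.rpow_def_of_pos (div_pos hx hμ),
      Real.log_div hx.ne' hμ.ne', ← Real.exp_add]
    congr 2
    ring
  rw [h1]
  calc x * Real.log (1 + v * M * (x / μ)) ≤ x * ((v * M * (x / μ)) ^ s / s) :=
        mul_le_mul_of_nonneg_left h2 hx.le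
    _ = _ := by rw [h3]; ring

lemma mul_exp_log_eq_rpow {x s : ℝ} (hx : 0 ≤ x) (hs : 0 < s) :
    x * Real.exp (s * Real.log x) = x ^ (1 + s) := by
  rcases hx.eq_or_lt with rfl | hx
  · rw [Real.zero_rpow (by linarith), zero_mul]
  · rw [Real.rpow_add hx, Real.rpow_one, Real.rpow_def_of_pos hx, mul_comm s]

section OneShot

variable {A F K : Type*} [Fintype A] [DecidableEq A] [Fintype F] [DecidableEq F]
  [Fintype K] [DecidableEq K]

/-- The state of the environment conditioned on `f` taking the value `b`, unnormalised. -/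
def fiberSum {B : Type*} [DecidableEq B] (X : A → Matrix F F ℂ) (f : A → B) (b : B) :
    Matrix F F ℂ := ∑ a, if f a = b then X a else 0

lemma fiberSum_sub {B : Type*} [DecidableEq B] {X : A → Matrix F F ℂ}
    (hX : ∀ a, (X a).PosSemidef) (f : A → B) (a : A) :
    (fiberSum X f (f a) - X a).PosSemidef := by
  have h := posSemidef_sum_sub (X := fun c => if f c = f a then X c else 0) (fun c => by
    split_ifs
    exacts [hX c, PosSemidef.zero]) a
  simpa [fiberSum] using h

lemma HashEnsemble.pos [Nonempty A] {M : ℕ} (H : HashEnsemble A M) : 0 < M := by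
  rcases Nat.eq_zero_or_pos M with rfl | h
  · have := H.weight_sum
    simp at this
  · exact h

/-- Summing over inputs instead of hash values makes `f` enter only through the logarithm of the
fibre containing `a`, where concavity can be used. -/
lemma mutualInfo'_applyFun {M : ℕ} (hM : 0 < M) {X : A → Matrix F F ℂ}
    (hX : ∀ a, (X a).PosSemidef) (htr : ∑ a, (X a).trace = 1) (f : A → Fin M) :
    mutualInfo' (applyFun f (cqMat X)) = Real.log M +
      ∑ a, ((X a * matLog (fiberSum X f (f a))).trace.re -
        (X a * matLog (∑ b, X b)).trace.re) := by
  have : Nonempty (Fin M) := ⟨⟨0, hM⟩⟩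
  rw [applyFun_cqMat, mutualInfo'_cqMat (fun b => posSemidef_fiber hX f b),
    condEntropy_cqMat (fun b => (posSemidef_fiber hX f b).isHermitian), sum_fiber,
    Fintype.card_fin, Finset.sum_sub_distrib, ← trace_sum_mul_re]
  · have : ∑ a, (X a * matLog (fiberSum X f (f a))).trace.re =
        -∑ b, vnEntropy (∑ a, if f a = b then X a else 0) := by
      rw [← sum_fiber _ f, ← Finset.sum_neg_distrib]
      refine Finset.sum_congr rfl fun b _ => ?_
      rw [vnEntropy, neg_neg, trace_sum_mul_re]
      refine Finset.sum_congr rfl fun a _ => ?_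
      split_ifs with h
      · rw [h, fiberSum]
      · simp
    rw [this, vnEntropy]
    ring
  · rw [← htr, ← sum_fiber (fun a => (X a).trace) f]
    refine Finset.sum_congr rfl fun b _ => ?_
    rw [trace_sum]
    refine Finset.sum_congr rfl fun a _ => ?_
    split_ifs <;> simp

/-- By operator concavity the mean logarithm is at most the logarithm of the mean fibre. That mean
contains `X a` with coefficient `1` and every other `X c` with its collision probability, at most `1
/ M`. The term in `ε` supplies the strict positivity that concavity requires. -/
lemma expect_trace_matLog_fiberSum_le {M : ℕ} {X : A → Matrix F F ℂ}
    (hX : ∀ a, (X a).PosSemidef) (H : HashEnsemble A M) (hH : H.IsUniversal2) (a : A) {ε : ℝ}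
    (hε : 0 < ε) :
    ∑ f, H.weight f * (X a * matLog (fiberSum X f (f a))).trace.re ≤
      (X a * matLog (X a + (((M : ℝ)⁻¹ : ℝ) : ℂ) • ∑ b, X b + (ε : ℂ) • 1)).trace.re := by
  have hfs : ∀ f : A → Fin M, (fiberSum X f (f a)).PosSemidef :=
    fun f => posSemidef_fiber hX f (f a)
  have h1 : ∀ f : A → Fin M, (X a * matLog (fiberSum X f (f a))).trace.re ≤
      (X a * matLog (fiberSum X f (f a) + (ε : ℂ) • 1)).trace.re := by
    intro f
    refine trace_mul_matLog_le_of_le (hX a) (hfs f) (fiberSum_sub hX f a) ?_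
    rw [add_sub_cancel_left]
    exact (PosSemidef.one).smul (Complex.zero_le_real.mpr hε.le)
  have h2 := posSemidef_matLog_sum Finset.univ (w := H.weight)
    (X := fun f => fiberSum X f (f a) + (ε : ℂ) • 1) (fun f _ => H.weight_nonneg f) H.weight_sum
    (fun f _ => posDef_add_smul_one (hfs f) hε)
  have h3 := trace_mul_re_nonneg (hX a) h2
  rw [Matrix.mul_sub, trace_sub, Complex.sub_re, Finset.mul_sum, trace_sum, Complex.re_sum] at h3
  have h4 : ∑ f, H.weight f * (X a * matLog (fiberSum X f (f a))).trace.re ≤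
      (X a * matLog (∑ f, (H.weight f : ℂ) • (fiberSum X f (f a) + (ε : ℂ) • 1))).trace.re := by
    refine le_trans (Finset.sum_le_sum fun f _ =>
      mul_le_mul_of_nonneg_left (h1 f) (H.weight_nonneg f)) ?_
    simpa using h3
  refine h4.trans ?_
  have h5 : ∑ f, (H.weight f : ℂ) • (fiberSum X f (f a) + (ε : ℂ) • 1) =
      (∑ f, (H.weight f : ℂ) • fiberSum X f (f a)) + (ε : ℂ) • (1 : Matrix F F ℂ) := by
    simp only [smul_add, Finset.sum_add_distrib, ← Finset.sum_smul, ← Complex.ofReal_sum,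
      H.weight_sum, Complex.ofReal_one, one_smul]
  rw [h5]
  have h6 : (∑ f, (H.weight f : ℂ) • fiberSum X f (f a)).PosSemidef :=
    posSemidef_sum _ fun f _ => (hfs f).smul (Complex.zero_le_real.mpr (H.weight_nonneg f))
  refine trace_mul_matLog_mono (hX a) (posDef_add_smul_one h6 hε) ?_
  rw [add_sub_add_right_eq_sub]
  -- The collision probability of `c` with `a`.
  let p : A → ℝ := fun c => ∑ f, if f c = f a then H.weight f else 0
  have h7 : ∑ f, (H.weight f : ℂ) • fiberSum X f (f a) = ∑ c, (p c : ℂ) • X c := by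
    simp only [fiberSum, Finset.smul_sum, p, Complex.ofReal_sum, Finset.sum_smul]
    rw [Finset.sum_comm]
    refine Finset.sum_congr rfl fun c _ => Finset.sum_congr rfl fun f _ => ?_
    split_ifs <;> simp
  have h8 : X a + (((M : ℝ)⁻¹ : ℝ) : ℂ) • ∑ b, X b - ∑ c, (p c : ℂ) • X c =
      ∑ c, (((if c = a then 1 else 0) + (M : ℝ)⁻¹ - p c : ℝ) : ℂ) • X c := by
    have : X a = ∑ c, (((if c = a then 1 else 0 : ℝ)) : ℂ) • X c := by
      rw [Finset.sum_eq_single a] <;> simp +contextual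
    conv_lhs => rw [this]
    rw [Finset.smul_sum, ← Finset.sum_add_distrib, ← Finset.sum_sub_distrib]
    refine Finset.sum_congr rfl fun c _ => ?_
    rw [← add_smul, ← sub_smul]
    push_cast
    rfl
  rw [h7, h8]
  refine posSemidef_sum _ fun c _ => (hX c).smul (Complex.zero_le_real.mpr ?_)
  by_cases hc : c = a
  · have : p c = 1 := by simp [p, hc, H.weight_sum]
    rw [if_pos hc, this]
    simp
  · have := hH c a hc
    rw [one_div] at this
    rw [if_neg hc]
    simp only [p]
    linarith

/-- The double sum is `Tr X^(1+s) Z^(-s)` on the support. After pinching all operators commute, and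
the bound reduces to scalars. `T` will be the averaged term of `expect_trace_matLog_fiberSum_le`. -/
lemma trace_matLog_le_sum_overlap (κ : F → K) {μ : K → ℝ} {U V : Matrix F F ℂ} {l : F → ℝ}
    {X Z : Matrix F F ℂ} (hX : X.PosSemidef) (hZp : Z.PosSemidef) (hXZ : (Z - X).PosSemidef)
    (hU : IsDiag U l X) (hZ : IsDiag V (fun j => μ (κ j)) Z) {M : ℝ} (hM : 0 < M) {s : ℝ}
    (hs : 0 < s) (hs1 : s ≤ 1) {T : ℝ}
    (hT : ∀ ε : ℝ, 0 < ε →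
      T ≤ (X * matLog (X + ((M⁻¹ : ℝ) : ℂ) • Z + (ε : ℂ) • 1)).trace.re) :
    T + Real.log M * X.trace.re - (X * matLog Z).trace.re ≤
      (Fintype.card K * M) ^ s / s * ∑ i, ∑ j, l i * Real.exp (s * Real.log (l i)) *
        overlap U V i j * Real.exp (-s * Real.log (μ (κ j))) := by
  obtain ⟨W, Y, hW, hY, hXY⟩ := exists_isDiag_pinching κ hX hZ
  set v : ℝ := (Fintype.card K : ℝ) with hv
  have hw0 : ∀ x, 0 ≤ weight W X x := weight_nonneg hX
  have hwz : ∀ x : (Σ k, {j // κ j = k}), μ x.1 = 0 → weight W X x = 0 :=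
    fun x hx => weight_eq_zero hW hX hXZ hx
  have hμ : ∀ x : (Σ k, {j // κ j = k}), 0 ≤ μ x.1 := fun x => hW.nonneg hZp x
  have hD := (hY.smul v).add (hW.smul M⁻¹)
  have hle : T ≤ ∑ x, weight W X x * Real.log (v * weight W X x + M⁻¹ * μ x.1) := by
    -- The limit `ε → 0` is taken only after pinching, where it concerns finitely many scalars.
    refine ge_of_tendsto (tendsto_finsetSum _ fun x _ => tendsto_mul_log_add (w := weight W X x)
      (d := v * weight W X x + M⁻¹ * μ x.1) fun h0 => ?_) ?_
    · have h1 : 0 ≤ v * weight W X x := mul_nonneg (Nat.cast_nonneg _) (hw0 x)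
      have h2 : 0 ≤ M⁻¹ * μ x.1 := mul_nonneg (by positivity) (hμ x)
      refine hwz x ?_
      have h3 : M⁻¹ * μ x.1 = 0 := by linarith
      exact (mul_eq_zero.mp h3).resolve_left (by positivity)
    · filter_upwards [self_mem_nhdsWithin] with ε hε
      have hε : 0 < ε := hε
      refine (hT ε hε).trans ?_
      rw [← (hD.add_smul_one ε).trace_mul_cfc X Real.log]
      refine trace_mul_matLog_mono hX (posDef_add_smul_one (hX.add
        (hZp.smul (Complex.zero_le_real.mpr (by positivity)))) hε) ?_
      rw [add_sub_add_right_eq_sub, add_sub_add_right_eq_sub]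
      simpa [hv] using hXY
  have h1 : (X * matLog Z).trace.re = ∑ x, weight W X x * Real.log (μ x.1) :=
    hW.trace_mul_cfc X Real.log
  have h2 : T + Real.log M * X.trace.re - (X * matLog Z).trace.re ≤
      ∑ x, weight W X x * (Real.log (v * weight W X x + M⁻¹ * μ x.1) + Real.log M
        - Real.log (μ x.1)) := by
    rw [h1, hW.trace_re X]
    simp only [mul_add, mul_sub, Finset.sum_add_distrib, Finset.sum_sub_distrib, ← Finset.sum_mul]
    linarith
  refine h2.trans ((Finset.sum_le_sum fun x _ => mul_log_le_rpow_mul_exp (hw0 x) (hμ x) (hwz x)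
    (Nat.cast_nonneg _) hM hs hs1).trans ?_)
  rw [← Finset.mul_sum]
  refine mul_le_mul_of_nonneg_left ?_ (div_nonneg (by positivity) hs.le)
  -- Pass from `V` to the pinching basis `W` of the same `Z`.
  rw [← hU.trace_cfc_mul_cfc hZ (fun t => t * Real.exp (s * Real.log t))
    (fun t => Real.exp (-s * Real.log t)), hU.trace_cfc_mul_cfc hW, Finset.sum_comm]
  refine Finset.sum_le_sum fun x _ => ?_
  rw [← Finset.sum_mul]
  refine mul_le_mul_of_nonneg_right ?_ (Real.exp_pos _).le
  have hl := hU.nonneg hX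
  -- The pinched eigenvalue is an average of the `l i` under the overlaps; convexity of `t^(1+s)`
  -- undoes the pinching.
  have hJ := Real.rpow_arith_mean_le_arith_mean_rpow Finset.univ (fun i => overlap U W i x) l
    (fun i _ => overlap_nonneg U W i x) (sum_overlap_left hU.mul_conj hW.conj_mul x)
    (fun i _ => hl i) (p := 1 + s) (by linarith)
  rw [mul_exp_log_eq_rpow (hw0 x) hs, hU.weight_eq_sum_overlap]
  simp only [mul_exp_log_eq_rpow (hl _) hs]
  simpa only [mul_comm] using hJ

/-- The leaked information after universal₂ hashing, averaged over the ensemble, is bounded by the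
conditional Rényi entropy of order `1 + s`. -/
theorem expect_mutualInfo'_le (κ : F → K) {μ : K → ℝ} {V : Matrix F F ℂ}
    {X U : A → Matrix F F ℂ} {l : A → F → ℝ} (hX : ∀ a, (X a).PosSemidef)
    (htr : ∑ a, (X a).trace = 1) (hU : ∀ a, IsDiag (U a) (l a) (X a))
    (hZ : IsDiag V (fun j => μ (κ j)) (∑ a, X a)) {M : ℕ} (hM : 0 < M) (H : HashEnsemble A M)
    (hH : H.IsUniversal2) {s : ℝ} (hs : 0 < s) (hs1 : s ≤ 1) :
    (H.expect fun f => mutualInfo' (applyFun f (cqMat X))) ≤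
      (Fintype.card K * M) ^ s / s * ∑ a, ∑ i, ∑ j, l a i * Real.exp (s * Real.log (l a i)) *
        overlap (U a) V i j * Real.exp (-s * Real.log (μ (κ j))) := by
  have hM' : (0 : ℝ) < M := by exact_mod_cast hM
  have hZp := posSemidef_sum Finset.univ fun a _ => hX a
  have hs' : ∑ a, (X a).trace.re = 1 := by
    rw [← Complex.re_sum, htr]; simp
  have h1 : (H.expect fun f => mutualInfo' (applyFun f (cqMat X))) =
      ∑ a, ((∑ f, H.weight f * (X a * matLog (fiberSum X f (f a))).trace.re) +
        Real.log M * (X a).trace.re - (X a * matLog (∑ b, X b)).trace.re) := by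
    simp only [HashEnsemble.expect, mutualInfo'_applyFun hM hX htr, mul_add, Finset.mul_sum,
      mul_sub, Finset.sum_add_distrib, Finset.sum_sub_distrib]
    simp only [← Finset.mul_sum, hs', mul_one]
    simp only [← Finset.sum_mul, H.weight_sum, one_mul]
    rw [Finset.sum_comm]
    simp only [Finset.mul_sum]
    ring
  rw [h1, Finset.mul_sum]
  exact Finset.sum_le_sum fun a _ => trace_matLog_le_sum_overlap κ (hX a) hZp
    (posSemidef_sum_sub hX a) (hU a) hZ hM' hs hs1
    fun ε hε => expect_trace_matLog_fiberSum_le hX H hH a hε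

end OneShot

/-! ### Tensor powers -/

section TensorPower

variable {A E F G : Type*} [Fintype A] [DecidableEq A] [Fintype E] [DecidableEq E]
  [Fintype F] [DecidableEq F] [Fintype G] [DecidableEq G] {n : ℕ}

/-- The tensor product of a family of matrices. -/
def tensorProd (Y : Fin n → Matrix E F ℂ) : Matrix (Fin n → E) (Fin n → F) ℂ :=
  Matrix.of fun i j => ∏ k, Y k (i k) (j k)

lemma tensorPow_cqMat (X : A → Matrix E E ℂ) :
    tensorPow n (cqMat X) = cqMat fun a => tensorProd fun k => X (a k) := by
  ext ⟨a, i⟩ ⟨b, j⟩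
  by_cases hab : a = b
  · subst hab
    simp [tensorPow, cqMat, tensorProd]
  · obtain ⟨k, hk⟩ := Function.ne_iff.mp hab
    simp only [tensorPow, cqMat, of_apply, hab, if_false]
    exact Finset.prod_eq_zero (Finset.mem_univ k) (if_neg hk)

lemma tensorProd_mul (X : Fin n → Matrix E F ℂ) (Y : Fin n → Matrix F G ℂ) :
    tensorProd X * tensorProd Y = tensorProd fun k => X k * Y k := by
  ext i j
  simp only [tensorProd, Matrix.mul_apply, of_apply, Finset.prod_univ_sum, Fintype.piFinset_univ,
    Finset.prod_mul_distrib]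

lemma tensorProd_conjTranspose (X : Fin n → Matrix E F ℂ) :
    (tensorProd X)ᴴ = tensorProd fun k => (X k)ᴴ := by
  ext i j
  simp [tensorProd]

lemma tensorProd_diagonal (d : Fin n → E → ℂ) :
    (tensorProd fun k => diagonal (d k)) = diagonal fun i => ∏ k, d k (i k) := by
  ext i j
  by_cases hij : i = j
  · subst hij
    simp [tensorProd]
  · obtain ⟨k, hk⟩ := Function.ne_iff.mp hij
    rw [diagonal_apply_ne _ hij]
    exact Finset.prod_eq_zero (Finset.mem_univ k) (diagonal_apply_ne _ hk)

lemma tensorProd_one : (tensorProd fun _ : Fin n => (1 : Matrix E E ℂ)) = 1 := by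
  simpa using tensorProd_diagonal fun (_ : Fin n) (_ : E) => (1 : ℂ)

lemma sum_tensorProd (X : A → Matrix E E ℂ) :
    ∑ a : Fin n → A, tensorProd (fun k => X (a k)) = tensorProd fun _ => ∑ a, X a := by
  ext i j
  simp only [tensorProd, Matrix.sum_apply, of_apply, Finset.prod_univ_sum, Fintype.piFinset_univ]

lemma trace_tensorProd (X : Fin n → Matrix E E ℂ) :
    (tensorProd X).trace = ∏ k, (X k).trace := by
  simp only [trace, diag_apply, tensorProd, of_apply, Finset.prod_univ_sum,
    Fintype.piFinset_univ]

lemma isDiag_tensorProd {V X : Fin n → Matrix E E ℂ} {d : Fin n → E → ℝ}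
    (h : ∀ k, IsDiag (V k) (d k) (X k)) :
    IsDiag (tensorProd V) (fun j => ∏ k, d k (j k)) (tensorProd X) := by
  refine ⟨?_, ?_, ?_⟩
  · rw [tensorProd_conjTranspose, tensorProd_mul, ← tensorProd_one]
    exact congrArg _ (funext fun k => (h k).conj_mul)
  · rw [tensorProd_conjTranspose, tensorProd_mul, ← tensorProd_one]
    exact congrArg _ (funext fun k => (h k).mul_conj)
  · have : diagonal (fun j : Fin n → E => ((∏ k, d k (j k) : ℝ) : ℂ)) =
        tensorProd fun k => diagonal fun i => (d k i : ℂ) := by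
      rw [tensorProd_diagonal]
      simp
    rw [this, tensorProd_conjTranspose, tensorProd_mul, tensorProd_mul]
    exact congrArg _ (funext fun k => (h k).eq)

lemma overlap_tensorProd (U V : Fin n → Matrix E E ℂ) (i j : Fin n → E) :
    overlap (tensorProd U) (tensorProd V) i j = ∏ k, overlap (U k) (V k) (i k) (j k) := by
  simp only [overlap]
  rw [tensorProd_conjTranspose, tensorProd_mul]
  simp only [tensorProd, of_apply, map_prod]

lemma IsDiag.posSemidef {V X : Matrix E E ℂ} {d : E → ℝ} (h : IsDiag V d X)
    (hd : ∀ i, 0 ≤ d i) : X.PosSemidef := by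
  rw [h.eq]
  refine PosSemidef.mul_mul_conjTranspose_same (posSemidef_diagonal_iff.mpr fun i => ?_) V
  exact Complex.zero_le_real.mpr (hd i)

lemma posSemidef_tensorProd {X : Fin n → Matrix E E ℂ} (hX : ∀ k, (X k).PosSemidef) :
    (tensorProd X).PosSemidef := by
  choose V d h using fun k => exists_isDiag (hX k).isHermitian
  exact (isDiag_tensorProd h).posSemidef fun i =>
    Finset.prod_nonneg fun k _ => (h k).nonneg (hX k) _

end TensorPower

/-! ### The joint spectral distribution -/

section Spectral

variable {A E : Type*} [Fintype A] [DecidableEq A] [Fintype E] [DecidableEq E] {n : ℕ}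

/-- The distribution of the pair of eigenvalues of `X a` and of `∑ a, X a`. -/
noncomputable def jointWeight (U : A → Matrix E E ℂ) (l : A → E → ℝ) (V : Matrix E E ℂ)
    (t : A × E × E) : ℝ := l t.1 t.2.1 * overlap (U t.1) V t.2.1 t.2.2

/-- The logarithmic ratio of the eigenvalues of `X a` and of `∑ a, X a`. -/
noncomputable def logRatio (l : A → E → ℝ) (μ : E → ℝ) (t : A × E × E) : ℝ :=
  Real.log (l t.1 t.2.1) - Real.log (μ t.2.2)

variable {X U : A → Matrix E E ℂ} {l : A → E → ℝ} {V : Matrix E E ℂ} {μ : E → ℝ}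

lemma jointWeight_nonneg (hX : ∀ a, (X a).PosSemidef) (hU : ∀ a, IsDiag (U a) (l a) (X a))
    (t : A × E × E) : 0 ≤ jointWeight U l V t :=
  mul_nonneg ((hU t.1).nonneg (hX t.1) _) (overlap_nonneg _ _ _ _)

lemma ne_zero_of_jointWeight (hX : ∀ a, (X a).PosSemidef) (hU : ∀ a, IsDiag (U a) (l a) (X a))
    (hV : IsDiag V μ (∑ a, X a)) {t : A × E × E} (ht : jointWeight U l V t ≠ 0) :
    l t.1 t.2.1 ≠ 0 ∧ μ t.2.2 ≠ 0 := by
  refine ⟨left_ne_zero_of_mul ht, fun h0 => ht ?_⟩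
  have hw := weight_eq_zero hV (hX t.1) (posSemidef_sum_sub hX t.1) h0
  rw [(hU t.1).weight_eq_sum_overlap, Finset.sum_eq_zero_iff_of_nonneg
    (fun i _ => mul_nonneg ((hU t.1).nonneg (hX t.1) i) (overlap_nonneg _ _ _ _))] at hw
  exact hw _ (Finset.mem_univ _)

lemma sum_jointWeight (hU : ∀ a, IsDiag (U a) (l a) (X a)) (hV : IsDiag V μ (∑ a, X a))
    (htr : ∑ a, (X a).trace = 1) : ∑ t, jointWeight U l V t = 1 := by
  rw [Fintype.sum_prod_type]
  have : ∀ a, ∑ y : E × E, jointWeight U l V (a, y) = (X a).trace.re := by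
    intro a
    rw [Fintype.sum_prod_type, (hU a).trace_self]
    refine Finset.sum_congr rfl fun i _ => ?_
    simp only [jointWeight]
    rw [← Finset.mul_sum, sum_overlap_right (hU a).conj_mul hV.mul_conj, mul_one]
  simp only [this]
  rw [← Complex.re_sum, htr, Complex.one_re]

/-- The classical distribution reproduces the quantum quantity exactly: the two halves of the log
ratio average to `∑ a, Tr X a log X a` and `Tr Z log Z`. -/
lemma sum_jointWeight_mul_logRatio (hU : ∀ a, IsDiag (U a) (l a) (X a))
    (hV : IsDiag V μ (∑ a, X a)) :
    ∑ t, jointWeight U l V t * logRatio l μ t = -condEntropy (cqMat X) := by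
  rw [condEntropy_cqMat fun a => (hU a).isHermitian, vnEntropy, trace_sum_mul_re]
  simp only [vnEntropy, Finset.sum_neg_distrib]
  rw [neg_sub, neg_sub_neg, ← Finset.sum_sub_distrib, Fintype.sum_prod_type]
  refine Finset.sum_congr rfl fun a _ => ?_
  rw [Fintype.sum_prod_type]
  simp only [jointWeight, logRatio, mul_sub, Finset.sum_sub_distrib]
  congr 1
  · rw [matLog, (hU a).trace_mul_cfc]
    refine Finset.sum_congr rfl fun i _ => ?_
    rw [← Finset.sum_mul, ← Finset.mul_sum, sum_overlap_right (hU a).conj_mul hV.mul_conj,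
      mul_one, (hU a).weight_self]
  · rw [matLog, hV.trace_mul_cfc, Finset.sum_comm]
    refine Finset.sum_congr rfl fun j _ => ?_
    rw [← Finset.sum_mul, (hU a).weight_eq_sum_overlap]

/-- Tuples of triples as triples of tuples. -/
def tripleEquiv (A E : Type*) (n : ℕ) :
    (Fin n → A × E × E) ≃ (Fin n → A) × (Fin n → E) × (Fin n → E) :=
  (Equiv.arrowProdEquivProdArrow (Fin n) (fun _ => A) (fun _ => E × E)).trans
    ((Equiv.refl _).prodCongr (Equiv.arrowProdEquivProdArrow (Fin n) (fun _ => E) fun _ => E))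

/-- On `n` copies the triples are independent and identically distributed. -/
lemma jointWeight_tripleEquiv (p : Fin n → A × E × E) :
    jointWeight (fun a : Fin n → A => tensorProd fun k => U (a k))
      (fun a i => ∏ k, l (a k) (i k)) (tensorProd fun _ => V) (tripleEquiv A E n p) =
      ∏ k, jointWeight U l V (p k) := by
  simp only [jointWeight, overlap_tensorProd, Finset.prod_mul_distrib]
  rfl

/-- Restricted to the support because the logarithm of a product splits only when no factor is zero.
-/
lemma logRatio_tripleEquiv (hX : ∀ a, (X a).PosSemidef) (hU : ∀ a, IsDiag (U a) (l a) (X a))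
    (hV : IsDiag V μ (∑ a, X a)) {p : Fin n → A × E × E}
    (hp : ∏ k, jointWeight U l V (p k) ≠ 0) :
    logRatio (fun (a : Fin n → A) i => ∏ k, l (a k) (i k)) (fun j => ∏ k, μ (j k))
      (tripleEquiv A E n p) = ∑ k, logRatio l μ (p k) := by
  have h := fun k => ne_zero_of_jointWeight hX hU hV
    (Finset.prod_ne_zero_iff.mp hp k (Finset.mem_univ k))
  simp only [logRatio, Finset.sum_sub_distrib]
  rw [← Real.log_prod fun k _ => (h k).1, ← Real.log_prod fun k _ => (h k).2]
  rfl

lemma sum_prod_mul_sum {T : Type*} [Fintype T] [DecidableEq T] {q : T → ℝ} (hq : ∑ t, q t = 1)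
    (L : T → ℝ) :
    ∑ p : Fin n → T, (∏ k, q (p k)) * ∑ k, L (p k) = n * ∑ t, q t * L t := by
  have h : ∀ k : Fin n, ∑ p : Fin n → T, (∏ j, q (p j)) * L (p k) = ∑ t, q t * L t := by
    intro k
    have h1 : ∀ p : Fin n → T, (∏ j, q (p j)) * L (p k) =
        ∏ j, q (p j) * (if j = k then L (p j) else 1) := by
      intro p
      rw [Finset.prod_mul_distrib, Finset.prod_ite_eq' Finset.univ k]
      simp
    have h2 := Finset.prod_univ_sum (fun _ : Fin n => (Finset.univ : Finset T))
      (fun j t => q t * (if j = k then L t else 1))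
    rw [Fintype.piFinset_univ] at h2
    simp only [h1]
    rw [← h2, Finset.prod_eq_single k]
    · simp
    · intro j _ hj
      simp [hj, hq]
    · simp
  simp only [Finset.mul_sum]
  rw [Finset.sum_comm]
  simp only [h, Finset.sum_const, Finset.card_univ, Fintype.card_fin, nsmul_eq_mul, Finset.mul_sum]

lemma condEntropy_tensorPow (hX : ∀ a, (X a).PosSemidef) (htr : ∑ a, (X a).trace = 1) :
    condEntropy (tensorPow n (cqMat X)) = n * condEntropy (cqMat X) := by
  choose U l hU using fun a => exists_isDiag (hX a).isHermitian
  obtain ⟨V, μ, hV⟩ := exists_isDiag (posSemidef_sum Finset.univ fun a _ => hX a).isHermitian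
  have hVn : IsDiag (tensorProd fun _ : Fin n => V) (fun j => ∏ k, μ (j k))
      (∑ a : Fin n → A, tensorProd fun k => X (a k)) := by
    rw [sum_tensorProd]
    exact isDiag_tensorProd fun _ => hV
  have h1 := sum_jointWeight_mul_logRatio (fun a : Fin n → A => isDiag_tensorProd fun k =>
    hU (a k)) hVn
  rw [← tensorPow_cqMat, ← (tripleEquiv A E n).sum_comp] at h1
  have h2 := sum_prod_mul_sum (n := n) (sum_jointWeight hU hV htr) (logRatio l μ)
  rw [sum_jointWeight_mul_logRatio hU hV] at h2
  have h3 : -condEntropy (tensorPow n (cqMat X)) = n * -condEntropy (cqMat X) := by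
    rw [← h1, ← h2]
    refine Finset.sum_congr rfl fun p _ => ?_
    rw [jointWeight_tripleEquiv]
    by_cases hp : ∏ k, jointWeight U l V (p k) = 0
    · rw [hp, zero_mul, zero_mul]
    · rw [logRatio_tripleEquiv hX hU hV hp]
  linarith

lemma sum_jointWeight_mul_exp_tensorPow (hX : ∀ a, (X a).PosSemidef)
    (hU : ∀ a, IsDiag (U a) (l a) (X a)) (hV : IsDiag V μ (∑ a, X a)) (s : ℝ) :
    ∑ t, jointWeight (fun a : Fin n → A => tensorProd fun k => U (a k))
      (fun a i => ∏ k, l (a k) (i k)) (tensorProd fun _ => V) t *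
      Real.exp (s * logRatio (fun (a : Fin n → A) i => ∏ k, l (a k) (i k))
        (fun j => ∏ k, μ (j k)) t) =
      (∑ t, jointWeight U l V t * Real.exp (s * logRatio l μ t)) ^ n := by
  rw [← (tripleEquiv A E n).sum_comp, Fintype.sum_pow]
  refine Finset.sum_congr rfl fun p _ => ?_
  rw [jointWeight_tripleEquiv, Finset.prod_mul_distrib]
  by_cases hp : ∏ k, jointWeight U l V (p k) = 0
  · rw [hp, zero_mul, zero_mul]
  · rw [logRatio_tripleEquiv hX hU hV hp, ← Real.exp_sum, Finset.mul_sum]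

/-- The number of occurrences of each letter in a tuple. -/
def letterCount (j : Fin n → E) (e : E) : Fin (n + 1) :=
  ⟨(Finset.univ.filter fun k => j k = e).card,
    Nat.lt_succ_of_le ((Finset.card_le_univ _).trans (by simp))⟩

/-- The eigenvalue depends on `j` only through its letter counts, so at most `(n + 1)^|E|` pinching
blocks are needed. -/
lemma prod_eq_prod_letterCount (μ : E → ℝ) (j : Fin n → E) :
    ∏ k, μ (j k) = ∏ e, μ e ^ (letterCount j e : ℕ) := by
  rw [← Finset.prod_fiberwise Finset.univ j]
  refine Finset.prod_congr rfl fun e _ => ?_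
  rw [Finset.prod_congr rfl fun k hk => by rw [(Finset.mem_filter.mp hk).2],
    Finset.prod_const]
  rfl

/-- The averaged leaked information of the `n`-fold state under universal₂ hashing. -/
theorem expect_mutualInfo'_tensorPow_le (hX : ∀ a, (X a).PosSemidef)
    (htr : ∑ a, (X a).trace = 1) (hU : ∀ a, IsDiag (U a) (l a) (X a))
    (hV : IsDiag V μ (∑ a, X a)) {M : ℕ} (hM : 0 < M) (H : HashEnsemble (Fin n → A) M)
    (hH : H.IsUniversal2) {s : ℝ} (hs : 0 < s) (hs1 : s ≤ 1) :
    (H.expect fun f => mutualInfo' (applyFun f (tensorPow n (cqMat X)))) ≤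
      (((n + 1) ^ Fintype.card E : ℕ) * M : ℝ) ^ s / s *
        (∑ t, jointWeight U l V t * Real.exp (s * logRatio l μ t)) ^ n := by
  have hVn : IsDiag (tensorProd fun _ : Fin n => V)
      (fun j => (fun c : E → Fin (n + 1) => ∏ e, μ e ^ (c e : ℕ)) (letterCount j))
      (∑ a : Fin n → A, tensorProd fun k => X (a k)) := by
    rw [sum_tensorProd]
    simpa only [prod_eq_prod_letterCount] using
      isDiag_tensorProd (n := n) fun _ => hV
  have htrn : ∑ a : Fin n → A, (tensorProd fun k => X (a k)).trace = 1 := by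
    rw [← trace_sum, sum_tensorProd, trace_tensorProd]
    simp [trace_sum, htr]
  have h := expect_mutualInfo'_le (letterCount (n := n) (E := E))
    (μ := fun c : E → Fin (n + 1) => ∏ e, μ e ^ (c e : ℕ)) (V := tensorProd fun _ => V) (fun a : Fin n → A =>
    posSemidef_tensorProd fun k => hX (a k)) htrn (fun a => isDiag_tensorProd fun k => hU (a k))
    hVn hM H hH hs hs1
  rw [tensorPow_cqMat]
  refine h.trans (le_of_eq ?_)
  have hc : Fintype.card (E → Fin (n + 1)) = (n + 1) ^ Fintype.card E := by simp
  rw [hc, ← sum_jointWeight_mul_exp_tensorPow hX hU hV, Fintype.sum_prod_type]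
  congr 1
  refine Finset.sum_congr rfl fun a _ => ?_
  rw [Fintype.sum_prod_type]
  refine Finset.sum_congr rfl fun i _ => Finset.sum_congr rfl fun j _ => ?_
  simp only [jointWeight, logRatio, ← prod_eq_prod_letterCount]
  rw [mul_sub, sub_eq_add_neg, Real.exp_add, ← neg_mul]
  ring

end Spectral

/-! ### Exponential decay -/

section Decay

lemma tendsto_log_succ_div : Tendsto (fun n : ℕ => Real.log (n + 1) / n) atTop (𝓝 0) := by
  -- The limit of `log x / (x - 1)` is taken along `x = n + 1`.
  have h := (Real.tendsto_pow_log_div_mul_add_atTop 1 (-1) 1 one_ne_zero).comp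
    (tendsto_atTop_add_const_right _ (1 : ℝ) tendsto_natCast_atTop_atTop)
  refine h.congr fun n => ?_
  simp

/-- The exponent vanishes at `s = 0` because `q` sums to `1`, and its derivative there is `R + ∑ t,
q t * L t < 0`. -/
lemma exists_exponent {T : Type*} [Fintype T] {q L : T → ℝ} (hq1 : ∑ t, q t = 1) {R : ℝ}
    (h : R + ∑ t, q t * L t < 0) :
    ∃ s : ℝ, 0 < s ∧ s ≤ 1 ∧
      s * R + Real.log (∑ t, q t * Real.exp (s * L t)) < 0 := by
  have h1 : HasDerivAt (fun s : ℝ => ∑ t, q t * Real.exp (s * L t)) (∑ t, q t * L t) 0 := by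
    have := HasDerivAt.fun_sum (u := Finset.univ) (A := fun t s => q t * Real.exp (s * L t))
      (A' := fun t => q t * L t) (x := (0 : ℝ)) fun t _ => by
        have h2 := (((hasDerivAt_id (0 : ℝ)).mul_const (L t)).exp).const_mul (q t)
        simpa using h2
    exact this
  have h2 : HasDerivAt (fun s : ℝ => s * R + Real.log (∑ t, q t * Real.exp (s * L t)))
      (R + ∑ t, q t * L t) 0 := by
    have h3 := h1.log (by simp [hq1])
    have h4 := ((hasDerivAt_id (0 : ℝ)).mul_const R).fun_add h3
    simpa [hq1] using h4
  have h5 := h2.tendsto_slope.eventually (Iio_mem_nhds h)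
  have h6 : ∀ᶠ s : ℝ in 𝓝[>] 0, slope (fun s : ℝ => s * R +
      Real.log (∑ t, q t * Real.exp (s * L t))) 0 s < 0 :=
    h5.filter_mono (nhdsWithin_mono 0 fun x (hx : 0 < x) => hx.ne')
  obtain ⟨s, hs, hs0, hs1⟩ := (h6.and (Ioc_mem_nhdsGT (zero_lt_one (α := ℝ)))).exists
  refine ⟨s, hs0, hs1, ?_⟩
  rw [slope_def_field] at hs
  simp only [zero_mul, Real.exp_zero, mul_one, hq1, Real.log_one, add_zero, sub_zero] at hs
  exact (div_neg_iff.mp hs).resolve_left (fun h => by linarith [h.2]) |>.1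

lemma eventually_bound_le_exp {M : ℕ → ℕ} (hM : ∀ n, 0 < M n) {R s φ : ℝ} (d : ℕ)
    (hR : Tendsto (fun n : ℕ => Real.log (M n) / n) atTop (𝓝 R)) (hs : 0 < s) (hφ : 0 < φ)
    (h : s * R + Real.log φ < 0) :
    ∃ c : ℝ, 0 < c ∧ ∀ᶠ n : ℕ in atTop,
      (((n + 1) ^ d : ℕ) * M n : ℝ) ^ s / s * φ ^ n ≤ Real.exp (-(c * n)) := by
  have hlim : Tendsto (fun n : ℕ => s * (d * (Real.log (n + 1) / n) + Real.log (M n) / n)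
      - Real.log s / n + Real.log φ) atTop (𝓝 (s * (d * 0 + R) - 0 + Real.log φ)) :=
    ((((tendsto_log_succ_div.const_mul _).add hR).const_mul s).sub
      (tendsto_const_div_atTop_nhds_zero_nat _)).add_const _
  have hlt : s * (d * 0 + R) - 0 + Real.log φ < (s * R + Real.log φ) / 2 := by
    rw [mul_zero, zero_add, sub_zero]; linarith
  -- The logarithm of the bound divided by `n` tends to `s * R + log φ`; half of it leaves room for
  -- the polynomial factor and `1 / s`.
  refine ⟨-((s * R + Real.log φ) / 2), by linarith, ?_⟩
  filter_upwards [hlim.eventually (Iio_mem_nhds hlt), eventually_gt_atTop 0] with n hn hn0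
  have hn0' : (0 : ℝ) < n := by exact_mod_cast hn0
  have hMn : (0 : ℝ) < M n := by exact_mod_cast hM n
  have hpos : (0 : ℝ) < ((n + 1) ^ d : ℕ) * M n := by positivity
  have hB : 0 < (((n + 1) ^ d : ℕ) * M n : ℝ) ^ s / s * φ ^ n := by positivity
  rw [← Real.log_le_iff_le_exp hB, Real.log_mul (by positivity) (by positivity),
    Real.log_div (by positivity) hs.ne', Real.log_rpow hpos, Real.log_mul (by positivity) hMn.ne',
    Real.log_pow]
  push_cast
  rw [Real.log_pow]
  have h1 : s * (d * (Real.log (n + 1) / n) + Real.log (M n) / n) - Real.log s / n + Real.log φ =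
      (s * (d * Real.log (n + 1) + Real.log (M n)) - Real.log s + n * Real.log φ) / n := by
    field_simp
  rw [h1, div_lt_iff₀ hn0'] at hn
  linarith

end Decay

/-! ### Rates -/

section Rate

variable {A E : Type*} [Fintype A] [DecidableEq A] [Fintype E] [DecidableEq E]

lemma CQState.nonempty (ρ : CQState A E) : Nonempty A := by
  by_contra h
  rw [not_nonempty_iff] at h
  simpa using ρ.prob_sum

/-- The unnormalised conditional states of the environment. -/
noncomputable def CQState.block (ρ : CQState A E) (a : A) : Matrix E E ℂ :=
  (ρ.prob a : ℂ) • ρ.state a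

lemma CQState.density_eq_cqMat (ρ : CQState A E) : ρ.density = cqMat ρ.block := density_eq ρ

lemma CQState.posSemidef_block (ρ : CQState A E) (a : A) : (ρ.block a).PosSemidef :=
  (ρ.state_posSemidef a).smul (Complex.zero_le_real.mpr (ρ.prob_nonneg a))

lemma CQState.trace_block (ρ : CQState A E) : ∑ a, (ρ.block a).trace = 1 := by
  simp only [CQState.block, trace_smul, ρ.state_trace, smul_eq_mul, mul_one]
  rw [← Complex.ofReal_sum, ρ.prob_sum, Complex.ofReal_one]

theorem meanLeak_le_exp (ρ : CQState A E) {R : ℝ} {M : ℕ → ℕ}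
    (X : ∀ n, HashEnsemble (Fin n → A) (M n)) (hR : R < condEntropy ρ.density)
    (hX : ∀ n, (X n).IsUniversal2)
    (hM : Tendsto (fun n : ℕ => Real.log (M n) / n) atTop (𝓝 R)) :
    ∃ c : ℝ, 0 < c ∧ ∀ᶠ n : ℕ in atTop, meanLeak ρ (X n) ≤ Real.exp (-(c * n)) := by
  have := ρ.nonempty
  have hMp : ∀ n, 0 < M n := fun n => (X n).pos
  choose U l hU using fun a => exists_isDiag (ρ.posSemidef_block a).isHermitian
  obtain ⟨V, μ, hV⟩ :=
    exists_isDiag (posSemidef_sum Finset.univ fun a _ => ρ.posSemidef_block a).isHermitian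
  have hq := sum_jointWeight hU hV ρ.trace_block
  have hL := sum_jointWeight_mul_logRatio hU hV
  rw [← ρ.density_eq_cqMat] at hL
  obtain ⟨s, hs, hs1, hneg⟩ := exists_exponent hq (L := logRatio l μ) (R := R)
    (by rw [hL]; linarith)
  have hφ : 0 < ∑ t, jointWeight U l V t * Real.exp (s * logRatio l μ t) := by
    have h0 := fun t => jointWeight_nonneg (V := V) ρ.posSemidef_block hU t
    refine (Finset.sum_nonneg fun t _ => mul_nonneg (h0 t) (Real.exp_pos _).le).lt_of_ne' ?_
    intro hz
    rw [Finset.sum_eq_zero_iff_of_nonneg fun t _ => mul_nonneg (h0 t) (Real.exp_pos _).le] at hz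
    have : ∑ t, jointWeight U l V t = 0 := Finset.sum_eq_zero fun t ht =>
      (mul_eq_zero.mp (hz t ht)).resolve_right (Real.exp_pos _).ne'
    linarith
  obtain ⟨c, hc, hb⟩ := eventually_bound_le_exp hMp (Fintype.card E) hM hs hφ hneg
  refine ⟨c, hc, hb.mono fun n hn => le_trans ?_ hn⟩
  rw [meanLeak, ρ.density_eq_cqMat]
  exact expect_mutualInfo'_tensorPow_le ρ.posSemidef_block ρ.trace_block hU hV (hMp n) (X n)
    (hX n) hs hs1

/-! ### Information identities and the converse for a single hash function. -/

section HashedState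

variable (ρ : CQState A E) {n M : ℕ} (f : (Fin n → A) → Fin M)

/-- The blocks of the `n`-fold state after hashing. -/
noncomputable def hashBlock (b : Fin M) : Matrix (Fin n → E) (Fin n → E) ℂ :=
  fiberSum (fun a : Fin n → A => tensorProd fun k => ρ.block (a k)) f b

lemma applyFun_tensorPow_density :
    applyFun f (tensorPow n ρ.density) = cqMat (hashBlock ρ f) := by
  rw [ρ.density_eq_cqMat, tensorPow_cqMat, applyFun_cqMat]
  rfl

lemma posSemidef_hashBlock (b : Fin M) : (hashBlock ρ f b).PosSemidef :=
  posSemidef_fiber (fun a : Fin n → A => posSemidef_tensorProd fun k => ρ.posSemidef_block (a k))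
    f b

lemma trace_hashBlock : ∑ b, (hashBlock ρ f b).trace = 1 := by
  rw [← trace_sum]
  simp only [hashBlock, fiberSum]
  rw [sum_fiber, sum_tensorProd, trace_tensorProd]
  simp [trace_sum, ρ.trace_block]

lemma hash_card_pos (ρ : CQState A E) (f : (Fin n → A) → Fin M) : 0 < M := by
  obtain ⟨a⟩ := ρ.nonempty
  exact (f fun _ => a).pos

lemma condEntropy_hash_le :
    condEntropy (applyFun f (tensorPow n ρ.density)) ≤ n * condEntropy ρ.density := by
  have h := condEntropy_tensorPow (n := n) ρ.posSemidef_block ρ.trace_block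
  have h2 := condEntropy_applyFun_le (fun a : Fin n → A =>
    posSemidef_tensorProd fun k => ρ.posSemidef_block (a k)) f
  rw [← tensorPow_cqMat, ← ρ.density_eq_cqMat] at h2
  rw [← ρ.density_eq_cqMat] at h
  exact h2.trans_eq h

lemma mutualInfo'_hash : mutualInfo' (applyFun f (tensorPow n ρ.density)) =
    Real.log M - condEntropy (applyFun f (tensorPow n ρ.density)) := by
  have : Nonempty (Fin M) := ⟨⟨0, hash_card_pos ρ f⟩⟩
  rw [applyFun_tensorPow_density,
    mutualInfo'_cqMat (posSemidef_hashBlock ρ f) (trace_hashBlock ρ f), Fintype.card_fin]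

lemma mutualInfo_hash : mutualInfo (applyFun f (tensorPow n ρ.density)) =
    entropyA (applyFun f (tensorPow n ρ.density)) -
      condEntropy (applyFun f (tensorPow n ρ.density)) := by
  rw [applyFun_tensorPow_density, mutualInfo_cqMat (posSemidef_hashBlock ρ f)]

lemma mutualInfo_hash_nonneg : 0 ≤ mutualInfo (applyFun f (tensorPow n ρ.density)) := by
  rw [applyFun_tensorPow_density]
  exact mutualInfo_cqMat_nonneg (posSemidef_hashBlock ρ f) (trace_hashBlock ρ f)

lemma entropyA_hash_le : entropyA (applyFun f (tensorPow n ρ.density)) ≤ Real.log M := by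
  have : Nonempty (Fin M) := ⟨⟨0, hash_card_pos ρ f⟩⟩
  have h := entropyA_le_log_card (posSemidef_hashBlock ρ f) (trace_hashBlock ρ f)
  rwa [Fintype.card_fin, ← applyFun_tensorPow_density] at h

lemma mutualInfo_le_mutualInfo'_hash : mutualInfo (applyFun f (tensorPow n ρ.density)) ≤
    mutualInfo' (applyFun f (tensorPow n ρ.density)) := by
  rw [mutualInfo_hash, mutualInfo'_hash]
  linarith [entropyA_hash_le ρ f]

lemma log_le_mutualInfo'_add : Real.log M ≤
    mutualInfo' (applyFun f (tensorPow n ρ.density)) + n * condEntropy ρ.density := by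
  rw [mutualInfo'_hash]
  linarith [condEntropy_hash_le ρ f]

end HashedState

/-! ### Ensembles of hash functions: averages, selection, and the uniform ensemble. -/

lemma meanLeak_nonneg (ρ : CQState A E) {n M : ℕ} (X : HashEnsemble (Fin n → A) M) :
    0 ≤ meanLeak ρ X :=
  Finset.sum_nonneg fun f _ => mul_nonneg (X.weight_nonneg f)
    ((mutualInfo_hash_nonneg ρ f).trans (mutualInfo_le_mutualInfo'_hash ρ f))

lemma log_le_meanLeak_add (ρ : CQState A E) {n M : ℕ} (X : HashEnsemble (Fin n → A) M) :
    Real.log M ≤ meanLeak ρ X + n * condEntropy ρ.density := by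
  have h := Finset.sum_le_sum fun f (_ : f ∈ Finset.univ) =>
    mul_le_mul_of_nonneg_left (log_le_mutualInfo'_add ρ f) (X.weight_nonneg f)
  simp only [mul_add, Finset.sum_add_distrib, ← Finset.sum_mul, X.weight_sum, one_mul] at h
  exact h

lemma exists_mutualInfo'_le_meanLeak (ρ : CQState A E) {n M : ℕ}
    (X : HashEnsemble (Fin n → A) M) :
    ∃ f : (Fin n → A) → Fin M, mutualInfo' (applyFun f (tensorPow n ρ.density)) ≤
      meanLeak ρ X := by
  by_contra! h
  have h1 : ∀ f ∈ Finset.univ, X.weight f * meanLeak ρ X ≤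
      X.weight f * mutualInfo' (applyFun f (tensorPow n ρ.density)) := fun f _ =>
    mul_le_mul_of_nonneg_left (h f).le (X.weight_nonneg f)
  have h2 : ∃ f ∈ Finset.univ, X.weight f * meanLeak ρ X <
      X.weight f * mutualInfo' (applyFun f (tensorPow n ρ.density)) := by
    obtain ⟨f, hf, hne⟩ := Finset.exists_ne_zero_of_sum_ne_zero
      (by rw [X.weight_sum]; exact one_ne_zero : ∑ f, X.weight f ≠ 0)
    exact ⟨f, hf, mul_lt_mul_of_pos_left (h f) ((X.weight_nonneg f).lt_of_ne' hne)⟩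
  have h3 := Finset.sum_lt_sum h1 h2
  rw [← Finset.sum_mul, X.weight_sum, one_mul] at h3
  exact lt_irrefl _ h3

/-- The uniform distribution on all functions. -/
noncomputable def uniformEnsemble (α : Type*) [Fintype α] [DecidableEq α] {M : ℕ} (hM : 0 < M) :
    HashEnsemble α M where
  weight _ := ((Fintype.card (α → Fin M) : ℝ))⁻¹
  weight_nonneg _ := by positivity
  weight_sum := by
    have : Nonempty (Fin M) := ⟨⟨0, hM⟩⟩
    have h : (Fintype.card (α → Fin M) : ℝ) ≠ 0 := by exact_mod_cast Fintype.card_ne_zero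
    rw [Finset.sum_const, Finset.card_univ, nsmul_eq_mul, mul_inv_cancel₀ h]

lemma isUniversal2_uniformEnsemble {α : Type*} [Fintype α] [DecidableEq α] {M : ℕ} (hM : 0 < M) :
    (uniformEnsemble α hM).IsUniversal2 := by
  intro a b hab
  have : NeZero M := ⟨hM.ne'⟩
  set w := ((Fintype.card (α → Fin M) : ℝ))⁻¹ with hw
  have hsum : ∑ _f : α → Fin M, w = 1 := (uniformEnsemble α hM).weight_sum
  -- Shifting the value at `a` by `c` is a bijection of functions that turns the event `f a = f b`
  -- into `f b - f a = c`. These `M` events partition all functions, so each has probability `1 /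
  -- M`.
  have h1 : ∀ c : Fin M, ∑ f : α → Fin M, (if f a = f b then w else 0) =
      ∑ f : α → Fin M, if c = f b - f a then w else 0 := by
    intro c
    rw [← Equiv.sum_comp (Equiv.addRight (Pi.single a c : α → Fin M))]
    refine Finset.sum_congr rfl fun f _ => ?_
    have e1 : (Equiv.addRight (Pi.single a c : α → Fin M)) f a = f a + c := by simp
    have e2 : (Equiv.addRight (Pi.single a c : α → Fin M)) f b = f b := by
      simp [Pi.single_eq_of_ne hab.symm]
    rw [e1, e2]
    refine if_congr ?_ rfl rfl
    rw [eq_sub_iff_add_eq, add_comm c]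
  have h2 : (M : ℝ) * ∑ f : α → Fin M, (if f a = f b then w else 0) = 1 := by
    have h3 : ∑ _c : Fin M, ∑ f : α → Fin M, (if f a = f b then w else 0) =
        M * ∑ f : α → Fin M, (if f a = f b then w else 0) := by
      rw [Finset.sum_const, Finset.card_univ, Fintype.card_fin, nsmul_eq_mul]
    rw [← h3, Finset.sum_congr rfl fun c _ => h1 c, Finset.sum_comm, ← hsum]
    exact Finset.sum_congr rfl fun f _ => by simp
  have hM' : (0 : ℝ) < M := by exact_mod_cast hM
  rw [le_div_iff₀ hM', mul_comm]
  exact h2.le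

/-! ### Limits and the three optimal rates. -/

lemma HasRate.le_ofReal {M : ℕ → ℕ} {R : ℝ≥0∞} (hR : HasRate M R) {x : ℕ → ℝ} {h : ℝ}
    (hx : Tendsto x atTop (𝓝 h)) (hle : ∀ᶠ n : ℕ in atTop, Real.log (M n) / n ≤ x n) :
    R ≤ ENNReal.ofReal h :=
  le_of_tendsto_of_tendsto hR (ENNReal.tendsto_ofReal hx)
    (hle.mono fun _ hn => ENNReal.ofReal_le_ofReal hn)

lemma exists_size {R : ℝ} (hR : 0 < R) : ∃ M : ℕ → ℕ, (∀ n, 0 < M n) ∧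
    Tendsto (fun n : ℕ => Real.log (M n) / n) atTop (𝓝 R) := by
  have hpos : ∀ n : ℕ, 0 < ⌈Real.exp (n * R)⌉₊ := fun n => Nat.ceil_pos.mpr (Real.exp_pos _)
  refine ⟨fun n => ⌈Real.exp (n * R)⌉₊, hpos, ?_⟩
  have hlim : Tendsto (fun n : ℕ => R + Real.log 2 / n) atTop (𝓝 (R + 0)) :=
    (tendsto_const_div_atTop_nhds_zero_nat _).const_add R
  rw [add_zero] at hlim
  refine tendsto_of_tendsto_of_tendsto_of_le_of_le' tendsto_const_nhds hlim ?_ ?_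
  · filter_upwards [eventually_gt_atTop 0] with n hn
    have hn' : (0 : ℝ) < n := by exact_mod_cast hn
    rw [le_div_iff₀ hn', Real.le_log_iff_exp_le (by exact_mod_cast hpos n), mul_comm]
    exact Nat.le_ceil _
  · filter_upwards [eventually_gt_atTop 0] with n hn
    have hn' : (0 : ℝ) < n := by exact_mod_cast hn
    -- Rounding up adds at most `1 ≤ exp (n R)`.
    have h1 : (⌈Real.exp (n * R)⌉₊ : ℝ) ≤ 2 * Real.exp (n * R) := by
      have h2 := (Nat.ceil_lt_add_one (Real.exp_pos (n * R)).le).le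
      have h3 : 1 ≤ Real.exp (n * R) := Real.one_le_exp (by positivity)
      linarith
    have h4 := Real.log_le_log (by exact_mod_cast hpos n) h1
    rw [Real.log_mul two_ne_zero (Real.exp_pos _).ne', Real.log_exp] at h4
    rw [div_le_iff₀ hn', add_mul, div_mul_cancel₀ _ hn'.ne']
    linarith

lemma exists_universal_sequence (ρ : CQState A E) {R : ℝ} (hR : 0 < R)
    (hR' : R < condEntropy ρ.density) :
    ∃ (M : ℕ → ℕ) (X : ∀ n, HashEnsemble (Fin n → A) (M n)), (∀ n, (X n).IsUniversal2) ∧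
      Tendsto (fun n : ℕ => Real.log (M n) / n) atTop (𝓝 R) ∧
      Tendsto (fun n : ℕ => meanLeak ρ (X n) / n) atTop (𝓝 0) := by
  obtain ⟨M, hM, hlim⟩ := exists_size hR
  refine ⟨M, fun n => uniformEnsemble _ (hM n), fun n => isUniversal2_uniformEnsemble (hM n),
    hlim, ?_⟩
  obtain ⟨c, hc, hb⟩ := meanLeak_le_exp ρ (fun n => uniformEnsemble (Fin n → A) (hM n)) hR'
    (fun n => isUniversal2_uniformEnsemble (hM n)) hlim
  refine tendsto_of_tendsto_of_tendsto_of_le_of_le' tendsto_const_nhds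
    (tendsto_const_div_atTop_nhds_zero_nat (1 : ℝ)) ?_ ?_
  · exact Eventually.of_forall fun n => div_nonneg (meanLeak_nonneg ρ _) (Nat.cast_nonneg n)
  · filter_upwards [hb] with n hn
    refine div_le_div_of_nonneg_right (hn.trans ?_) (Nat.cast_nonneg n)
    exact Real.exp_le_one_iff.mpr (by have : 0 ≤ c * n := by positivity
                                      linarith)

lemma exists_hash_sequence (ρ : CQState A E) {R : ℝ} (hR : 0 < R)
    (hR' : R < condEntropy ρ.density) :
    ∃ (M : ℕ → ℕ) (f : ∀ n, (Fin n → A) → Fin (M n)),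
      Tendsto (fun n : ℕ => Real.log (M n) / n) atTop (𝓝 R) ∧
      Tendsto (fun n : ℕ => mutualInfo' (applyFun (f n) (tensorPow n ρ.density)) / n)
        atTop (𝓝 0) := by
  obtain ⟨M, X, -, hM, hX⟩ := exists_universal_sequence ρ hR hR'
  choose f hf using fun n => exists_mutualInfo'_le_meanLeak ρ (X n)
  refine ⟨M, f, hM, squeeze_zero (fun n => ?_) (fun n => ?_) hX⟩
  · exact div_nonneg ((mutualInfo_hash_nonneg ρ _).trans (mutualInfo_le_mutualInfo'_hash ρ _))
      (Nat.cast_nonneg n)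
  · exact div_le_div_of_nonneg_right (hf n) (Nat.cast_nonneg n)

lemma tendsto_mutualInfo_div (ρ : CQState A E) {M : ℕ → ℕ} {f : ∀ n, (Fin n → A) → Fin (M n)}
    (h : Tendsto (fun n : ℕ => mutualInfo' (applyFun (f n) (tensorPow n ρ.density)) / n)
      atTop (𝓝 0)) :
    Tendsto (fun n : ℕ => mutualInfo (applyFun (f n) (tensorPow n ρ.density)) / n)
      atTop (𝓝 0) :=
  squeeze_zero (fun n => div_nonneg (mutualInfo_hash_nonneg ρ _) (Nat.cast_nonneg n))
    (fun n => div_le_div_of_nonneg_right (mutualInfo_le_mutualInfo'_hash ρ _) (Nat.cast_nonneg n))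
    h

/-- Since `I ≥ 0`, the entropy lies between `log M - I'` and `log M`. A positive rate makes `I'`
negligible against `log M`. -/
lemma tendsto_entropyA_div_log (ρ : CQState A E) {M : ℕ → ℕ}
    {f : ∀ n, (Fin n → A) → Fin (M n)} {R : ℝ} (hR : 0 < R)
    (hM : Tendsto (fun n : ℕ => Real.log (M n) / n) atTop (𝓝 R))
    (h : Tendsto (fun n : ℕ => mutualInfo' (applyFun (f n) (tensorPow n ρ.density)) / n)
      atTop (𝓝 0)) :
    Tendsto (fun n : ℕ => entropyA (applyFun (f n) (tensorPow n ρ.density)) / Real.log (M n))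
      atTop (𝓝 1) := by
  have h1 : Tendsto (fun n : ℕ => 1 - (mutualInfo' (applyFun (f n) (tensorPow n ρ.density)) / n) /
      (Real.log (M n) / n)) atTop (𝓝 (1 - 0 / R)) := (h.div hM hR.ne').const_sub 1
  rw [zero_div, sub_zero] at h1
  refine tendsto_of_tendsto_of_tendsto_of_le_of_le' h1 tendsto_const_nhds ?_ ?_
  all_goals
    filter_upwards [eventually_gt_atTop 0, hM.eventually (Ioi_mem_nhds hR)] with n hn hpos
    have hn' : (0 : ℝ) < n := by exact_mod_cast hn
    have hlog : 0 < Real.log (M n) := by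
      have := mul_pos (show 0 < Real.log (M n) / n from hpos) hn'
      rwa [div_mul_cancel₀ _ hn'.ne'] at this
  · rw [div_div_div_cancel_right₀ hn'.ne', le_div_iff₀ hlog, sub_mul, one_mul,
      div_mul_cancel₀ _ hlog.ne']
    have h2 := mutualInfo_hash_nonneg ρ (f n)
    rw [mutualInfo_hash] at h2
    rw [mutualInfo'_hash]
    linarith
  · rw [div_le_one hlog]
    exact entropyA_hash_le ρ _

lemma hasRate_ofReal {M : ℕ → ℕ} {R : ℝ}
    (hM : Tendsto (fun n : ℕ => Real.log (M n) / n) atTop (𝓝 R)) :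
    HasRate M (ENNReal.ofReal R) := ENNReal.tendsto_ofReal hM

/-- Strictly positive rates below `h` suffice: if `h ≤ 0` there are none, and the upper bound is
already `0`. -/
lemma sSup_eq_ofReal {S : Set ℝ≥0∞} {h : ℝ} (hub : ∀ R ∈ S, R ≤ ENNReal.ofReal h)
    (hmem : ∀ R : ℝ, 0 < R → R < h → ENNReal.ofReal R ∈ S) : sSup S = ENNReal.ofReal h := by
  refine le_antisymm (sSup_le hub) (le_of_forall_lt fun c hc => ?_)
  obtain ⟨R, hR0, hcR, hRh⟩ := ENNReal.lt_iff_exists_real_btwn.mp hc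
  have hR : 0 < R := ENNReal.ofReal_pos.mp (zero_le.trans_lt hcR)
  exact hcR.trans_le (le_sSup (hmem R hR (ENNReal.ofReal_lt_ofReal_iff_of_nonneg hR0 |>.mp hRh)))

theorem optimalRate'_eq (ρ : CQState A E) :
    optimalRate' ρ = ENNReal.ofReal (condEntropy ρ.density) := by
  refine sSup_eq_ofReal ?_ ?_
  · rintro R ⟨M, f, hR, hI⟩
    refine hR.le_ofReal (by simpa using hI.add_const (condEntropy ρ.density)) ?_
    filter_upwards [eventually_gt_atTop 0] with n hn
    have hn' : (0 : ℝ) < n := by exact_mod_cast hn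
    rw [div_add' _ _ _ hn'.ne', mul_comm (condEntropy ρ.density)]
    exact div_le_div_of_nonneg_right (log_le_mutualInfo'_add ρ (f n)) hn'.le
  · intro R hR hRh
    obtain ⟨M, f, hM, hf⟩ := exists_hash_sequence ρ hR hRh
    exact ⟨M, f, hasRate_ofReal hM, hf⟩

theorem optimalRateUniversal2_eq (ρ : CQState A E) :
    optimalRateUniversal2 ρ = ENNReal.ofReal (condEntropy ρ.density) := by
  refine sSup_eq_ofReal ?_ ?_
  · rintro R ⟨M, X, -, hR, hI⟩
    refine hR.le_ofReal (by simpa using hI.add_const (condEntropy ρ.density)) ?_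
    filter_upwards [eventually_gt_atTop 0] with n hn
    have hn' : (0 : ℝ) < n := by exact_mod_cast hn
    rw [div_add' _ _ _ hn'.ne', mul_comm (condEntropy ρ.density)]
    exact div_le_div_of_nonneg_right (log_le_meanLeak_add ρ (X n)) hn'.le
  · intro R hR hRh
    obtain ⟨M, X, hX, hM, hf⟩ := exists_universal_sequence ρ hR hRh
    exact ⟨M, X, hX, hasRate_ofReal hM, hf⟩

theorem optimalRate_eq (ρ : CQState A E) :
    optimalRate ρ = ENNReal.ofReal (condEntropy ρ.density) := by
  refine sSup_eq_ofReal ?_ ?_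
  · rintro R ⟨M, f, hR, hI, hH⟩
    -- `log M / n` is `H(f(A)) / n` divided by `H(f(A)) / log M`, and `H(f(A)) ≤ I + n H(A|E)`.
    have hlim := (hI.add_const (condEntropy ρ.density)).div hH one_ne_zero
    rw [zero_add, div_one] at hlim
    refine hR.le_ofReal hlim ?_
    filter_upwards [eventually_gt_atTop 0, hH.eventually (Ioi_mem_nhds zero_lt_one)] with n hn hr
    have hn' : (0 : ℝ) < n := by exact_mod_cast hn
    have hr' : 0 < entropyA (applyFun (f n) (tensorPow n ρ.density)) / Real.log (M n) := hr
    -- Division by zero would give the ratio `0`, which is excluded once it is close to `1`.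
    have hlog : Real.log (M n) ≠ 0 := fun h0 => by simp [h0] at hr'
    rw [Pi.div_apply, le_div_iff₀ hr']
    have e : Real.log (M n) / n * (entropyA (applyFun (f n) (tensorPow n ρ.density)) /
        Real.log (M n)) = entropyA (applyFun (f n) (tensorPow n ρ.density)) / n := by
      field_simp
    rw [e, div_add' _ _ _ hn'.ne', mul_comm (condEntropy ρ.density), mutualInfo_hash]
    exact div_le_div_of_nonneg_right (by linarith [condEntropy_hash_le ρ (f n)]) hn'.le
  · intro R hR hRh
    obtain ⟨M, f, hM, hf⟩ := exists_hash_sequence ρ hR hRh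
    exact ⟨M, f, hasRate_ofReal hM, tendsto_mutualInfo_div ρ hf,
      tendsto_entropyA_div_log ρ hR hM hf⟩

/-- Conditional entropy of a classical system is nonnegative, so the truncation in `ENNReal.ofReal`
loses nothing. -/
lemma coe_ofReal_condEntropy (ρ : CQState A E) :
    ((ENNReal.ofReal (condEntropy ρ.density) : ℝ≥0∞) : EReal) =
      ((condEntropy ρ.density : ℝ) : EReal) := by
  rw [EReal.coe_ennreal_ofReal, max_eq_left]
  rw [ρ.density_eq_cqMat]
  exact condEntropy_cqMat_nonneg ρ.posSemidef_block

end Rate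

end SecretKey

theorem mainTheorem6 {A E : Type*} [Fintype A] [DecidableEq A] [Fintype E] [DecidableEq E]
    (ρ : SecretKey.CQState A E) :
    (SecretKey.optimalRate ρ : EReal) = ((SecretKey.condEntropy ρ.density : ℝ) : EReal) ∧
    (SecretKey.optimalRate' ρ : EReal) = ((SecretKey.condEntropy ρ.density : ℝ) : EReal) ∧
    (SecretKey.optimalRateUniversal2 ρ : EReal) =
      ((SecretKey.condEntropy ρ.density : ℝ) : EReal) ∧
    (∀ (R : ℝ) (M : ℕ → ℕ) (X : ∀ n, SecretKey.HashEnsemble (Fin n → A) (M n)),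
      R < SecretKey.condEntropy ρ.density →
      (∀ n, (X n).IsUniversal2) →
      Tendsto (fun n : ℕ => Real.log (M n) / n) atTop (𝓝 R) →
      ∃ c : ℝ, 0 < c ∧ ∀ᶠ n : ℕ in atTop,
        SecretKey.meanLeak ρ (X n) ≤ Real.exp (-(c * n))) := by
  refine ⟨?_, ?_, ?_, fun R M X hR hX hM => SecretKey.meanLeak_le_exp ρ X hR hX hM⟩
  · rw [SecretKey.optimalRate_eq, SecretKey.coe_ofReal_condEntropy]
  · rw [SecretKey.optimalRate'_eq, SecretKey.coe_ofReal_condEntropy]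
  · rw [SecretKey.optimalRateUniversal2_eq, SecretKey.coe_ofReal_condEntropy]
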